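/- **Channel.** Fix real coefficients $h_{k\ell}$ ($k,\ell\in\{1,2,3\}$) and positive integers $M_{12},M_{13},M_{23}$; put $M_{\ell k}=M_{k\ell}$, and $s_{k\ell}=M_{k\ell}$ if $\ell<k$, $s_{k\ell}=0$ if $\ell>k$. In a block of length $n$ user $k$ sends $X_k[0],\dots,X_k[n-1]\in\mathbb C$ (symbols with time index outside $0,\dots,n-1$ are $0$), and the filter of index $f\in\mathbb Z$ at receiver $k$ puts out at time $j$ $$Y_{k,f}[j]=X_k[j]\,e^{i\Phi_k[j]}\,U_{k,f}[j]+Z_{k,f}[j],$$ $$\Phi_k[j]=h_{kk}|X_k[j]|^2+\sum_{\ell\ne k}h_{k\ell}\sum_{r=1}^{M_{k\ell}}|X_\ell[j+s_{k\ell}-r]|^2,\qquad V_k[j]=\sum_{\ell\neq k}\frac{h_{k\ell}}{2\pi}\bigl(|X_\ell[j+s_{k\ell}]|^2-|X_\ell[j+s_{k\ell}-M_{k\ell}]|^2\bigr),$$ where $U_{k,f}[j]=1$ if $V_k[j]=f$ and $U_{k,f}[j]=\frac{e^{i2\pi(V_k[j]-f)}-1}{i2\pi(V_k[j]-f)}$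 otherwise. The $Z_{k,f}[j]$ are i.i.d. circularly-symmetric complex Gaussian with mean $0$ and variance $N>0$, independent of the inputs; the inputs of different users are independent. Receiver $k$ observes $\mathbf Y_k[j]=(Y_{k,f}[j])_{f\in\mathcal F_k}$ for a finite bank $\mathcal F_k\subset\mathbb Z$. **Pulse and filters.** Let $p\in L^2(\mathbb R)$ vanish outside $[0,T_s]$ and have energy $E_s>0$, and let $K(t)=\frac1{E_s}\int_0^t|p|^2$ and $h_f(t)=p^*(-t)e^{-i2\pi fK(-t)}$. **Pre-logs.** A scheme assigns to every $(P,N)$ block input laws, of average power $\frac1n\sum_j\mathbb E|X_k[j]|^2\le P$, and filter banks. It achieves the high-power pre-log triple $(r_1,r_2,r_3)$ if for all $N>0$ and all $k$ the rates $R_k(P,N)=\lim_{n}\frac1nI(X_k^n;\mathbf Y_k^n)$ exist for all $P>0$, are finite, and $\lim_{P\to\infty}R_k(P,N)/\log(P/N)=r_k$. **Theorem.** Assume that $h_{k\ell}$ is rational for all $k\ne\ell$. Let $\hat p_\ell$ be the least common multiple of the denominators of the two numbers $h_{k\ell}$, $k\ne\ell$. Then: 1. The field $\sum_m X_k[m]\,p(t-mT_s)\,e^{i(\Phi_k[m]+2\pi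 V_k[m]K(t-mT_s))}$, convolved with $h_f$ and sampled at $jT_s$, equals $E_s X_k[j]e^{i\Phi_k[j]}U_{k,f}[j]$. Moreover $\int h_f(jT_s-t)\,h_{f'}^*(j'T_s-t)\,dt$ is $E_s$ if $(j,f)=(j',f')$ and $0$ otherwise. 2. Let $\mathcal P_\ell$ be finite sets of numbers $2\pi\hat p_\ell m$, $m\in\{0,1,2,\dots\}$, and let $\mathcal F_k$ be the set of all $\sum_{\ell\ne k}h_{k\ell}(p_\ell-p_\ell')/2\pi$ with $p_\ell,p'_\ell\in\mathcal P_\ell$. Then $\mathcal F_k\subset\mathbb Z$. If $|X_\ell[j]|^2\in\mathcal P_\ell$ for all $\ell,j$, then $V_k[j]\in\mathbb Z$, $Y_{k,f}[j]=X_k[j]e^{ih_{kk}|X_k[j]|^2}+Z_{k,f}[j]$ for $f=V_k[j]$, and $Y_{k,f}[j]=Z_{k,f}[j]$ for all other $f$. Moreover $V_k[j]\in\mathcal F_k$ whenever all time indices in $V_k[j]$ lie in the block. 3. For all block input laws, independent across users, with $|X_\ell[j]|^2\in2\pi\hat p_\ell\{0,1,2,\dots\}$ almost surely, the pair $\bigl(X_k^n,(Y_{k,V_k[j]}[j])_j\bigr)$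 has the law of $\bigl(X_k^n,(X_k[j]e^{ih_{kk}|X_k[j]|^2}+W[j])_j\bigr)$ with $W[j]$ i.i.d. circularly-symmetric complex Gaussian of variance $N$, independent of $X_k^n$; that is, this branch is a memoryless AWGN channel. 4. The high-power pre-log triple $(1,1,1)$ is achieved by a scheme with i.i.d. inputs that satisfy, at each $(P,N)$, $|X_\ell[j]|^2\in\mathcal P_\ell(P,N)$ almost surely for finite sets $\mathcal P_\ell(P,N)\subset2\pi\hat p_\ell\{0,1,2,\dots\}$ (of positive numbers once $P$ is large, for each $N$), and with the banks $\mathcal F_k$ that belong to these sets as in 2. -/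

import Mathlib

open MeasureTheory ProbabilityTheory Filter Topology
open scoped ENNReal NNReal

noncomputable section

namespace WDM

/-! ### The channel -/

/-- Parameters of the three-user discrete-time WDM channel with group-velocity mismatch:
the channel coefficients `h k l` (`h k k` for SPM, `h k l` with `k ≠ l` for XPM) and the walk-off
lengths `M k l`, in symbols, of the pairs `k < l`; entries of `M` with `l ≤ k` are not used. -/
structure Channel where
  h : Fin 3 → Fin 3 → ℝ
  M : Fin 3 → Fin 3 → ℕ
  M_pos : ∀ k l, k < l → 0 < M k l

namespace Channel

variable (c : Channel)

/-- The walk-off length of the unordered pair `{k, l}`. -/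
def lag (k l : Fin 3) : ℕ := c.M (min k l) (max k l)

/-- How many symbols the window of user `l` seen by receiver `k` is shifted to the future:
nothing if `k < l`, and the whole walk-off length if `l < k`. -/
def lead (k l : Fin 3) : ℕ := if l < k then c.lag k l else 0

end Channel

/-- Instantaneous power `|x[t]|²` at an integer time `t` of a codeword `x[0], …, x[n-1]`;
quantities with a time index outside the codeword are zero. -/
def power {n : ℕ} (x : Fin n → ℂ) (t : ℤ) : ℝ :=
  if ht : 0 ≤ t ∧ t < n then ‖x ⟨t.toNat, by omega⟩‖ ^ 2 else 0

namespace Channel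

variable (c : Channel)

/-- The phase `Φ_k[j]`. -/
def Phi {n : ℕ} (x : Fin 3 → Fin n → ℂ) (k : Fin 3) (j : Fin n) : ℝ :=
  c.h k k * ‖x k j‖ ^ 2 +
    ∑ l ∈ Finset.univ.erase k, c.h k l *
      ∑ r ∈ Finset.Icc 1 (c.lag k l), power (x l) ((j : ℤ) + c.lead k l - r)

/-- The normalized frequency shift `V_k[j]`. -/
def V {n : ℕ} (x : Fin 3 → Fin n → ℂ) (k : Fin 3) (j : Fin n) : ℝ :=
  ∑ l ∈ Finset.univ.erase k, c.h k l *
    (power (x l) ((j : ℤ) + c.lead k l) - power (x l) ((j : ℤ) + c.lead k l - c.lag k l)) /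
      (2 * Real.pi)

/-- Times at which `V_k[j]` involves no symbol outside the codewords. -/
def Interior (n : ℕ) (k : Fin 3) (j : Fin n) : Prop :=
  ∀ l, l ≠ k → 0 ≤ (j : ℤ) + c.lead k l - c.lag k l ∧ (j : ℤ) + c.lead k l < n

end Channel

/-- The gain `U` of the filter of index `f` when the normalized frequency shift is `v`. -/
def gain (v : ℝ) (f : ℤ) : ℂ :=
  if v = f then 1
  else (Complex.exp (Complex.I * (2 * Real.pi * (v - f) : ℝ)) - 1) /
    (Complex.I * (2 * Real.pi * (v - f) : ℝ))

/-- Noise samples: `z (k, j, f)` is the noise at receiver `k`, time `j`, filter `f`. -/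
abbrev Noise (n : ℕ) : Type := Fin 3 × Fin n × ℤ → ℂ

namespace Channel

variable (c : Channel)

/-- The noiseless part of the output of filter `f` of receiver `k` at time `j`. -/
def clean {n : ℕ} (x : Fin 3 → Fin n → ℂ) (k : Fin 3) (j : Fin n) (f : ℤ) : ℂ :=
  x k j * Complex.exp (Complex.I * (c.Phi x k j : ℝ)) * gain (c.V x k j) f

/-- The output `Y_{k,f}[j]`. -/
def output {n : ℕ} (x : Fin 3 → Fin n → ℂ) (z : Noise n) (k : Fin 3) (j : Fin n) (f : ℤ) : ℂ :=
  c.clean x k j f + z (k, j, f)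

end Channel

/-! ### The pulse and the bank of matched filters -/

/-- A pulse of finite energy `E` that vanishes outside `[0, Ts]`. -/
structure Pulse where
  p : ℝ → ℂ
  Ts : ℝ
  E : ℝ
  Ts_pos : 0 < Ts
  E_pos : 0 < E
  memLp : MemLp p 2 volume
  timeLimited : ∀ t, t ∉ Set.Icc 0 Ts → p t = 0
  energy : ∫ t in (0 : ℝ)..Ts, ‖p t‖ ^ 2 = E

namespace Pulse

variable (g : Pulse)

/-- The normalized running energy `K(t)` of the pulse. -/
def K (t : ℝ) : ℝ := 1 / g.E * ∫ s in (0 : ℝ)..t, ‖g.p s‖ ^ 2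

/-- Impulse response `h_f(t) = p*(-t) exp(-i 2π f K(-t))` of the filter of index `f`. -/
def filter (f : ℤ) (t : ℝ) : ℂ :=
  (starRingEnd ℂ) (g.p (-t)) * Complex.exp (-(Complex.I * (2 * Real.pi * f * g.K (-t) : ℝ)))

/-- The noiseless field at receiver `k`, in the time frame that moves with carrier `k`: in symbol
slot `m` the pulse carries `x_k[m]` and the phase `Φ_k[m] + 2π V_k[m] K(t - m Ts)`. -/
def field (c : Channel) {n : ℕ} (x : Fin 3 → Fin n → ℂ) (k : Fin 3) (t : ℝ) : ℂ :=
  ∑ m : Fin n, x k m * g.p (t - (m : ℕ) * g.Ts) *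
    Complex.exp (Complex.I *
      (c.Phi x k m + 2 * Real.pi * c.V x k m * g.K (t - (m : ℕ) * g.Ts) : ℝ))

end Pulse

/-! ### Laws, mutual information and pre-logs -/

/-- Circularly-symmetric complex Gaussian law with mean `0` and variance `N`. -/
def cgauss (N : ℝ) : Measure ℂ :=
  ((gaussianReal 0 (N / 2).toNNReal).prod (gaussianReal 0 (N / 2).toNNReal)).map
    (fun w : ℝ × ℝ => (w.1 : ℂ) + w.2 * Complex.I)

instance (N : ℝ) : IsProbabilityMeasure (cgauss N) :=
  Measure.isProbabilityMeasure_map (by fun_prop)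

/-- Law of all inputs and all noise samples in a block of length `n`: the users are independent
with block input laws `Q k`, and the noise samples are i.i.d. and independent of the inputs. -/
def blockLaw (N : ℝ) {n : ℕ} (Q : Fin 3 → Measure (Fin n → ℂ)) :
    Measure ((Fin 3 → Fin n → ℂ) × Noise n) :=
  (Measure.pi Q).prod (Measure.infinitePi fun _ : Fin 3 × Fin n × ℤ => cgauss N)

/-- Mutual information `I(X;Y)` in nats. -/
def mutualInfo {Ω A B : Type*} [MeasurableSpace Ω] [MeasurableSpace A] [MeasurableSpace B]
    (μ : Measure Ω) (X : Ω → A) (Y : Ω → B) : ℝ≥0∞ :=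
  InformationTheory.klDiv (μ.map fun ω => (X ω, Y ω)) ((μ.map X).prod (μ.map Y))

/-- `I(X_k^n; Y_k^n)`, where receiver `k` observes the outputs of the filters in the bank `F`. -/
def Channel.blockInfo (c : Channel) (N : ℝ) {n : ℕ} (Q : Fin 3 → Measure (Fin n → ℂ))
    (F : Finset ℤ) (k : Fin 3) : ℝ≥0∞ :=
  mutualInfo (blockLaw N Q) (fun ω => ω.1 k)
    (fun ω => fun (j : Fin n) (f : F) => c.output ω.1 ω.2 k j f)

/-- A scheme: for every power `P` and noise variance `N`, input laws of all users for every block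
length, and filter banks of all receivers. -/
structure Scheme where
  inputLaw : ℝ → ℝ → (n : ℕ) → Fin 3 → Measure (Fin n → ℂ)
  bank : ℝ → ℝ → Fin 3 → Finset ℤ

/-- The average power constraint `(1/n) ∑ E|X[j]|² ≤ P`. -/
def PowerConstraint (P : ℝ) {n : ℕ} (Q : Measure (Fin n → ℂ)) : Prop :=
  ∑ j, ∫⁻ x, ‖x j‖ₑ ^ 2 ∂Q ≤ n * ENNReal.ofReal P

/-- The scheme obeys the power constraints and achieves the high-power pre-log triple `r`:
for every noise variance `N`, each information rate `R_k(P,N) = lim (1/n) I(X_k^n; Y_k^n)` exists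
and is finite, and `R_k(P,N) / log(P/N) → r k` as `P → ∞`. -/
def Scheme.AchievesHighPowerPrelog (S : Scheme) (c : Channel) (r : Fin 3 → ℝ) : Prop :=
  (∀ P N : ℝ, 0 < P → 0 < N → ∀ (n : ℕ) (k : Fin 3),
    IsProbabilityMeasure (S.inputLaw P N n k) ∧ PowerConstraint P (S.inputLaw P N n k)) ∧
  ∀ N : ℝ, 0 < N → ∀ k : Fin 3, ∃ R : ℝ → ℝ≥0,
    (∀ P : ℝ, 0 < P →
      Tendsto (fun n : ℕ => c.blockInfo N (S.inputLaw P N n) (S.bank P N k) k / (n : ℝ≥0∞))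
        atTop (𝓝 (R P : ℝ≥0∞))) ∧
    Tendsto (fun P : ℝ => (R P : ℝ) / Real.log (P / N)) atTop (𝓝 (r k))

/-! ### Interference focusing -/

/-- `p̂_l`: the least common multiple of the denominators of the coefficients `a k l`, `k ≠ l`. -/
def pHat (a : Fin 3 → Fin 3 → ℚ) (l : Fin 3) : ℕ :=
  (Finset.univ.erase l).lcm fun k => (a k l).den

/-- The powers `2π p̂_l m`, `m = 0, 1, 2, …`, that user `l` may use. -/
def allowedPowers (a : Fin 3 → Fin 3 → ℚ) (l : Fin 3) : Set ℝ :=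
  Set.range fun m : ℕ => 2 * Real.pi * pHat a l * m

namespace Channel

variable (c : Channel)

/-- The frequency shifts that receiver `k` can see if user `l` uses the powers in `W l`: all sums
`∑_{l ≠ k} d_l` with `d_l` of the form `h_{kl} (p - p') / 2π`, `p, p' ∈ W l`. -/
def shifts (W : Fin 3 → Finset ℝ) (k : Fin 3) : Finset ℝ :=
  (Fintype.piFinset fun l => W l ×ˢ W l).image fun d =>
    ∑ l ∈ Finset.univ.erase k, c.h k l * ((d l).1 - (d l).2) / (2 * Real.pi)

/-- The bank of receiver `k`: the integers in `shifts W k`. -/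
def focusBank (W : Fin 3 → Finset ℝ) (k : Fin 3) : Finset ℤ :=
  (c.shifts W k).preimage (fun f : ℤ => (f : ℝ)) (Int.cast_injective.injOn)

/-- The scheme in which, at `(P, N)`, user `k` sends i.i.d. symbols with law `ρ P N k`, and the
filter banks are those of the power sets `W P N`. -/
def focusScheme (W : ℝ → ℝ → Fin 3 → Finset ℝ) (ρ : ℝ → ℝ → Fin 3 → Measure ℂ) : Scheme where
  inputLaw P N n k := Measure.pi fun _ : Fin n => ρ P N k
  bank P N k := c.focusBank (W P N) k

end Channel

end WDM

end

/-!
The receiver side of the theorem is exact. The running energy `K` of the pulse carries `|p|² dt`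
to a multiple of Lebesgue measure on `[0, 1]`, so a matched filter in its own symbol slot computes
`∫₀¹ exp (2πi (v - f) u) du`, which is the gain (`Pulse.integral_sq_mul_exp`). As `p` is only
square integrable, the change of variables rests on the fundamental theorem of calculus for
absolutely continuous functions (`integral_mul_comp_integral`).

If the powers of user `l` are multiples of `2π p̂_l`, the cross-phase modulation is a multiple of
`2π` and the frequency shifts are integers. The gain at integers is `0` or `1`, so one branch
carries the signal and the others carry noise (`Channel.clean_eq_ite`). The index of this branch
depends on the inputs only, hence the noise of the selected branch is again i.i.d. and independent
of the inputs (`measurePreserving_select_noise`).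

For the pre-logs, the receiver observes the whole bank, and the index of the branch that carries
the signal depends, through the walk-off, on the symbols of the other users at several times; so
the channel with inputs of all users taken as random has memory.
* The rates exist by Fekete's lemma. Two blocks sent one after the other differ from two separate
  blocks by a signal near the junction that takes a bounded number of values, and revealing it
  costs a bounded amount of information (`mutualInfo_prodMk_le_add_log`); this makes the block
  information subadditive up to a constant (`slotInfo_add_le`, `exists_rate`).
* The rates are at most the entropy `log |A|` of the symbols.
* For the lower bound, the receiver finds the symbol by minimum distance decoding of the bank: it
  looks for one branch close to a point of the constellation, all others being close to `0`. This
  fails only if one of the noise samples of the bank is large. The Donsker–Varadhan bound turns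
  this decoder into a lower bound for the block information without any analysis of the joint law
  of the outputs (`integral_sub_log_le_klDiv`, `le_slotInfo`).
* The constellation has about `S` points on each of about `S` rings of radii between `d S` and
  `2 d S` (`ringSet`). Self-phase modulation rotates every ring rigidly, so the minimum distance is
  of order `d`. With `d` of order `(log P)²`, the bank has at most `P³` filters and the noise
  exceeds `d / 8` with probability of order `exp (-(log P)² / 8)` at most, so the error
  probability vanishes, while `log |A| = 2 log (S + 1) = log P - O(log log P)`.
-/

noncomputable section

namespace WDM

/-! ### Divergence and mutual information -/

section Divergence

open InformationTheory

variable {α β γ : Type*} [MeasurableSpace α] [MeasurableSpace β] [MeasurableSpace γ]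

lemma klDiv_le_log_of_le_smul {μ ν : Measure α} [IsProbabilityMeasure μ] [IsProbabilityMeasure ν]
    {C : ℝ≥0} (h : μ ≤ C • ν) : klDiv μ ν ≤ ENNReal.ofReal (Real.log C) := by
  have hac : μ ≪ ν := (Measure.absolutelyContinuous_of_le h).trans
    (Measure.smul_absolutelyContinuous (c := C))
  have hle : ∀ᵐ x ∂ν, μ.rnDeriv ν x ≤ C := by
    refine ae_le_of_forall_setLIntegral_le_of_sigmaFinite (Measure.measurable_rnDeriv _ _)
      fun s hs _ => ?_
    calc ∫⁻ x in s, μ.rnDeriv ν x ∂ν ≤ μ s := Measure.setLIntegral_rnDeriv_le s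
      _ ≤ (C • ν) s := h s
      _ = ∫⁻ x in s, C ∂ν := by
        rw [setLIntegral_const, Measure.smul_apply, ENNReal.smul_def, smul_eq_mul]
  have hle' : ∀ᵐ x ∂ν, (μ.rnDeriv ν x).toReal ≤ C := by
    filter_upwards [hle] with x hx
    exact ENNReal.toReal_le_coe_of_le_coe hx
  have hint : Integrable (llr μ ν) μ := by
    rw [← integrable_rnDeriv_mul_log_iff hac]
    obtain ⟨B, hB⟩ := (isCompact_Icc (a := (0 : ℝ)) (b := C)).exists_bound_of_continuousOn
      Real.continuous_mul_log.continuousOn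
    refine Integrable.of_bound (by fun_prop) B ?_
    filter_upwards [hle'] with x hx
    exact hB _ ⟨ENNReal.toReal_nonneg, hx⟩
  rw [klDiv_of_ac_of_integrable hac hint]
  refine ENNReal.ofReal_le_ofReal ?_
  have h1 : ∫ x, llr μ ν x ∂μ ≤ ∫ _, Real.log C ∂μ := by
    refine integral_mono_ae hint (integrable_const _) ?_
    filter_upwards [hac.ae_le hle', Measure.rnDeriv_pos hac,
      hac.ae_le (Measure.rnDeriv_lt_top μ ν)] with x hx h0 htop
    exact Real.log_le_log (ENNReal.toReal_pos h0.ne' htop.ne) hx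
  simpa using h1

lemma klDiv_swap (μ ν : Measure (α × β)) [IsFiniteMeasure μ] [IsFiniteMeasure ν] :
    klDiv (μ.map Prod.swap) (ν.map Prod.swap) = klDiv μ ν := by
  refine le_antisymm (klDiv_map_le _ _ measurable_swap) ?_
  have h := klDiv_map_le (μ.map Prod.swap) (ν.map Prod.swap)
    (measurable_swap : Measurable (Prod.swap : β × α → α × β))
  rwa [Measure.map_map measurable_swap measurable_swap,
    Measure.map_map measurable_swap measurable_swap, Prod.swap_swap_eq, Measure.map_id,
    Measure.map_id] at h

lemma klDiv_prod_add (μ₁ ν₁ : Measure α) (μ₂ ν₂ : Measure β) [IsProbabilityMeasure μ₁]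
    [IsProbabilityMeasure ν₁] [IsProbabilityMeasure μ₂] [IsProbabilityMeasure ν₂] :
    klDiv (μ₁.prod μ₂) (ν₁.prod ν₂) = klDiv μ₁ ν₁ + klDiv μ₂ ν₂ := by
  rw [← Measure.compProd_const, ← Measure.compProd_const, klDiv_compProd_eq_add]
  congr 1
  rw [Measure.compProd_const, Measure.compProd_const, ← klDiv_swap, Measure.prod_swap,
    Measure.prod_swap, ← Measure.compProd_const, ← Measure.compProd_const, klDiv_compProd_left]

/-- Among all product measures with a given second factor, the first marginal of `μ` gives the
least divergence. -/
lemma klDiv_prod_fst_le [StandardBorelSpace β] [Nonempty β] (μ : Measure (α × β))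
    [IsProbabilityMeasure μ] (R : Measure α) [IsProbabilityMeasure R] (ν : Measure β)
    [IsProbabilityMeasure ν] : klDiv μ (μ.fst.prod ν) ≤ klDiv μ (R.prod ν) := by
  have h := klDiv_compProd_eq_add μ.fst R μ.condKernel (Kernel.const α ν)
  rw [μ.disintegrate, Measure.compProd_const, Measure.compProd_const] at h
  rw [h]
  exact le_add_self

/-- The variational lower bound of Donsker and Varadhan. -/
lemma integral_sub_log_le_klDiv {μ ν : Measure α} [IsProbabilityMeasure μ]
    [IsProbabilityMeasure ν] {f : α → ℝ} (hfμ : Integrable f μ)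
    (hfν : Integrable (fun x => Real.exp (f x)) ν) (hf : ∫ x, Real.exp (f x) ∂ν ≤ 1) :
    ENNReal.ofReal (∫ x, f x ∂μ) ≤ klDiv μ ν := by
  by_cases hac : μ ≪ ν
  swap
  · simp [klDiv_of_not_ac hac]
  by_cases hint : Integrable (llr μ ν) μ
  swap
  · simp [klDiv_of_not_integrable hint]
  rw [klDiv_of_ac_of_integrable hac hint]
  refine ENNReal.ofReal_le_ofReal ?_
  have : IsProbabilityMeasure (ν.tilted f) := isProbabilityMeasure_tilted hfν
  have hac' : μ ≪ ν.tilted f := hac.trans (absolutelyContinuous_tilted hfν)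
  have hint' := integrable_llr_tilted_right hac hfμ hint hfν
  have h0 := integral_llr_add_sub_measure_univ_nonneg hac' hint'
  rw [integral_llr_tilted_right hac hfμ hfν hint] at h0
  have h1 : Real.log (∫ x, Real.exp (f x) ∂ν) ≤ 0 :=
    Real.log_nonpos (integral_nonneg fun x => (Real.exp_pos _).le) hf
  simp only [probReal_univ] at h0 ⊢
  linarith

end Divergence

section MutualInfo

open InformationTheory

variable {Ω Ω' A A' B B' S : Type*} [MeasurableSpace Ω] [MeasurableSpace Ω'] [MeasurableSpace A]
  [MeasurableSpace A'] [MeasurableSpace B] [MeasurableSpace B'] [MeasurableSpace S]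

lemma mutualInfo_map (μ : Measure Ω) {φ : Ω → Ω'} (hφ : Measurable φ) {X : Ω' → A} {Y : Ω' → B}
    (hX : Measurable X) (hY : Measurable Y) :
    mutualInfo (μ.map φ) X Y = mutualInfo μ (fun ω => X (φ ω)) (fun ω => Y (φ ω)) := by
  unfold mutualInfo
  rw [Measure.map_map (hX.prodMk hY) hφ, Measure.map_map hX hφ, Measure.map_map hY hφ]
  rfl

lemma measurePreserving_middleSwap (μ₁ : Measure A) (μ₂ : Measure B) (ν₁ : Measure A')
    (ν₂ : Measure B') [IsProbabilityMeasure μ₁] [IsProbabilityMeasure μ₂]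
    [IsProbabilityMeasure ν₁] [IsProbabilityMeasure ν₂] :
    MeasurePreserving (fun p : (A × B) × (A' × B') => ((p.1.1, p.2.1), (p.1.2, p.2.2)))
      ((μ₁.prod μ₂).prod (ν₁.prod ν₂)) ((μ₁.prod ν₁).prod (μ₂.prod ν₂)) :=
  ((measurePreserving_prodAssoc μ₁ ν₁ (μ₂.prod ν₂)).symm.comp
    ((MeasurePreserving.id μ₁).prod
      ((measurePreserving_prodAssoc ν₁ μ₂ ν₂).comp
        ((Measure.measurePreserving_swap.prod (MeasurePreserving.id ν₂)).comp
          (measurePreserving_prodAssoc μ₂ ν₁ ν₂).symm)))).comp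
    (measurePreserving_prodAssoc μ₁ μ₂ (ν₁.prod ν₂))

variable (μ : Measure Ω) [IsProbabilityMeasure μ]

/-- The data processing inequality. -/
lemma mutualInfo_comp_le {X : Ω → A} {Y : Ω → B} (hX : Measurable X)
    (hY : Measurable Y) {f : A → A'} {g : B → B'} (hf : Measurable f) (hg : Measurable g) :
    mutualInfo μ (fun ω => f (X ω)) (fun ω => g (Y ω)) ≤ mutualInfo μ X Y := by
  have := Measure.isProbabilityMeasure_map (μ := μ) hX.aemeasurable
  have := Measure.isProbabilityMeasure_map (μ := μ) hY.aemeasurable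
  have := Measure.isProbabilityMeasure_map (μ := μ) (hX.prodMk hY).aemeasurable
  have h := klDiv_map_le (μ.map fun ω => (X ω, Y ω)) ((μ.map X).prod (μ.map Y)) (hf.prodMap hg)
  rw [Measure.map_map (hf.prodMap hg) (hX.prodMk hY), ← Measure.map_prod_map _ _ hf hg,
    Measure.map_map hf hX, Measure.map_map hg hY] at h
  exact h

lemma mutualInfo_comm {X : Ω → A} {Y : Ω → B} (hX : Measurable X) (hY : Measurable Y) :
    mutualInfo μ X Y = mutualInfo μ Y X := by
  have := Measure.isProbabilityMeasure_map (μ := μ) hX.aemeasurable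
  have := Measure.isProbabilityMeasure_map (μ := μ) hY.aemeasurable
  have := Measure.isProbabilityMeasure_map (μ := μ) (hX.prodMk hY).aemeasurable
  unfold mutualInfo
  rw [← klDiv_swap, Measure.prod_swap, Measure.map_map measurable_swap (hX.prodMk hY)]
  rfl

lemma mutualInfo_prod_le (ν : Measure Ω') [IsProbabilityMeasure ν] {X : Ω → A} {Y : Ω → B}
    {X' : Ω' → A'} {Y' : Ω' → B'} (hX : Measurable X) (hY : Measurable Y) (hX' : Measurable X')
    (hY' : Measurable Y') :
    mutualInfo (μ.prod ν) (fun ω => (X ω.1, X' ω.2)) (fun ω => (Y ω.1, Y' ω.2)) ≤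
      mutualInfo μ X Y + mutualInfo ν X' Y' := by
  have := Measure.isProbabilityMeasure_map (μ := μ) hX.aemeasurable
  have := Measure.isProbabilityMeasure_map (μ := μ) hY.aemeasurable
  have := Measure.isProbabilityMeasure_map (μ := μ) (hX.prodMk hY).aemeasurable
  have := Measure.isProbabilityMeasure_map (μ := ν) hX'.aemeasurable
  have := Measure.isProbabilityMeasure_map (μ := ν) hY'.aemeasurable
  have := Measure.isProbabilityMeasure_map (μ := ν) (hX'.prodMk hY').aemeasurable
  have h1 : (μ.prod ν).map (fun ω => ((X ω.1, X' ω.2), (Y ω.1, Y' ω.2))) =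
      ((μ.map fun ω => (X ω, Y ω)).prod (ν.map fun ω => (X' ω, Y' ω))).map
        (fun p => ((p.1.1, p.2.1), (p.1.2, p.2.2))) := by
    rw [Measure.map_prod_map _ _ (hX.prodMk hY) (hX'.prodMk hY'),
      Measure.map_map (by fun_prop) (by fun_prop)]
    rfl
  have h2 : (μ.prod ν).map (fun ω => (X ω.1, X' ω.2)) = (μ.map X).prod (ν.map X') :=
    (Measure.map_prod_map _ _ hX hX').symm
  have h3 : (μ.prod ν).map (fun ω => (Y ω.1, Y' ω.2)) = (μ.map Y).prod (ν.map Y') :=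
    (Measure.map_prod_map _ _ hY hY').symm
  unfold mutualInfo
  rw [h1, h2, h3, ← (measurePreserving_middleSwap (μ.map X) (μ.map Y) (ν.map X')
    (ν.map Y')).map_eq, ← klDiv_prod_add]
  exact klDiv_map_le _ _ (by fun_prop)

lemma lintegral_uniformOn_finset [MeasurableSingletonClass S] (s : Finset S) (f : S → ℝ≥0∞) :
    ∫⁻ a, f a ∂(uniformOn (s : Set S)) = (∑ a ∈ s, f a) / s.card := by
  rw [uniformOn, ProbabilityTheory.cond, lintegral_smul_measure, lintegral_finset,
    Measure.count_apply_finset, ENNReal.div_eq_inv_mul]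
  simp

/-- If the second component takes values in the finite set `s`, then the joint law is dominated by
`|s|` times the product of the first marginal and the uniform law on `s`. -/
lemma le_card_smul_prod_uniformOn [MeasurableSingletonClass S] (P : Measure (A × S))
    [IsProbabilityMeasure P] (s : Finset S) (hs : s.Nonempty) (hP : ∀ᵐ p ∂P, p.2 ∈ s) :
    P ≤ (s.card : ℝ≥0) • P.fst.prod (uniformOn (s : Set S)) := by
  classical
  have := isProbabilityMeasure_uniformOn (s := (s : Set S)) s.finite_toSet (by simpa using hs)
  refine Measure.le_iff.2 fun t ht => ?_
  have hcard : (s.card : ℝ≥0∞) ≠ 0 := by simpa using hs.ne_empty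
  calc P t ≤ P (⋃ a ∈ s, Prod.fst ⁻¹' ((fun x => (x, a)) ⁻¹' t) ∩ {p | p.2 = a}) := by
        refine measure_mono_ae ?_
        filter_upwards [hP] with p hp hpt
        exact Set.mem_iUnion₂.2 ⟨p.2, hp, hpt, rfl⟩
    _ ≤ ∑ a ∈ s, P.fst ((fun x => (x, a)) ⁻¹' t) := by
        refine (measure_biUnion_finset_le _ _).trans (Finset.sum_le_sum fun a _ => ?_)
        rw [Measure.fst_apply (measurable_prodMk_right ht)]
        exact measure_mono Set.inter_subset_left
    _ = ((s.card : ℝ≥0) • P.fst.prod (uniformOn (s : Set S))) t := by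
        rw [Measure.smul_apply, Measure.prod_apply_symm ht, lintegral_uniformOn_finset,
          ENNReal.smul_def, smul_eq_mul, ENNReal.coe_natCast,
          ENNReal.mul_div_cancel hcard (by simp)]

/-- Revealing a variable with values in a finite set `s` to the observer raises the mutual
information by at most `log |s|`. -/
lemma mutualInfo_prodMk_le_add_log [StandardBorelSpace A] [StandardBorelSpace S] [Nonempty A]
    {X : Ω → A} {T : Ω → B} {D : Ω → S} (hX : Measurable X) (hT : Measurable T)
    (hD : Measurable D) (s : Finset S) (hs : ∀ᵐ ω ∂μ, D ω ∈ s) :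
    mutualInfo μ X (fun ω => (T ω, D ω)) ≤
      mutualInfo μ X T + ENNReal.ofReal (Real.log s.card) := by
  have hne : s.Nonempty := (hs.exists).elim fun ω h => ⟨_, h⟩
  have : Nonempty S := ⟨hne.choose⟩
  have := isProbabilityMeasure_uniformOn (s := (s : Set S)) s.finite_toSet (by simpa using hne)
  have := Measure.isProbabilityMeasure_map (μ := μ) hX.aemeasurable
  have := Measure.isProbabilityMeasure_map (μ := μ) hT.aemeasurable
  have := Measure.isProbabilityMeasure_map (μ := μ) (hT.prodMk hX).aemeasurable
  have := Measure.isProbabilityMeasure_map (μ := μ) ((hT.prodMk hD).prodMk hX).aemeasurable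
  have := Measure.isProbabilityMeasure_map (μ := μ) ((hT.prodMk hX).prodMk hD).aemeasurable
  rw [mutualInfo_comm μ hX (hT.prodMk hD), mutualInfo_comm μ hX hT]
  set U := uniformOn (s : Set S)
  set P := μ.map (fun ω => ((T ω, X ω), D ω)) with hPdef
  have hPfst : P.fst = μ.map fun ω => (T ω, X ω) := by
    rw [Measure.fst, Measure.map_map measurable_fst (by fun_prop)]; rfl
  have hr : Measurable fun p : (B × A) × S => ((p.1.1, p.2), p.1.2) := by fun_prop
  have hPmap : μ.map (fun ω => ((T ω, D ω), X ω)) =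
      P.map (fun p : (B × A) × S => ((p.1.1, p.2), p.1.2)) := by
    rw [hPdef, Measure.map_map hr (by fun_prop)]; rfl
  have hmid : (((μ.map T).prod (μ.map X)).prod U).map
      (fun p : (B × A) × S => ((p.1.1, p.2), p.1.2)) = ((μ.map T).prod U).prod (μ.map X) :=
    (((measurePreserving_prodAssoc (μ.map T) U (μ.map X)).symm.comp
      ((MeasurePreserving.id (μ.map T)).prod Measure.measurePreserving_swap)).comp
      (measurePreserving_prodAssoc (μ.map T) (μ.map X) U)).map_eq
  calc mutualInfo μ (fun ω => (T ω, D ω)) X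
      ≤ klDiv (μ.map fun ω => ((T ω, D ω), X ω)) (((μ.map T).prod U).prod (μ.map X)) := by
        have h := klDiv_prod_fst_le (μ.map fun ω => ((T ω, D ω), X ω)) ((μ.map T).prod U)
          (μ.map X)
        rwa [Measure.fst_map_prodMk hX] at h
    _ ≤ klDiv P (((μ.map T).prod (μ.map X)).prod U) := by
        rw [hPmap, ← hmid]
        exact klDiv_map_le _ _ hr
    _ = klDiv (μ.map fun ω => (T ω, X ω)) ((μ.map T).prod (μ.map X)) +
          klDiv P (P.fst.prod U) := by
        have h := klDiv_compProd_eq_add P.fst ((μ.map T).prod (μ.map X)) P.condKernel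
          (Kernel.const _ U)
        rw [P.disintegrate, Measure.compProd_const, Measure.compProd_const, hPfst] at h
        rwa [hPfst]
    _ ≤ mutualInfo μ T X + ENNReal.ofReal (Real.log s.card) := by
        refine add_le_add le_rfl ((klDiv_le_log_of_le_smul
          (le_card_smul_prod_uniformOn P s hne ?_)).trans_eq (by simp))
        rw [hPdef, ae_map_iff (by fun_prop)
          (show MeasurableSet {p : (B × A) × S | p.2 ∈ s} from measurable_snd s.measurableSet)]
        exact hs

/-- The mutual information with a variable that takes values in a finite set `s` is at most
`log |s|`. -/
lemma mutualInfo_le_log_card [StandardBorelSpace A] [StandardBorelSpace B] [Nonempty B]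
    {X : Ω → A} {Y : Ω → B} (hX : Measurable X) (hY : Measurable Y) (s : Finset A)
    (hs : ∀ᵐ ω ∂μ, X ω ∈ s) : mutualInfo μ X Y ≤ ENNReal.ofReal (Real.log s.card) := by
  have := Measure.isProbabilityMeasure_map (μ := μ) hY.aemeasurable
  rw [mutualInfo_comm μ hX hY]
  have h := mutualInfo_prodMk_le_add_log μ hY (measurable_const (a := ())) hX s hs
  have h0 : mutualInfo μ Y (fun _ => ()) = 0 := by
    unfold mutualInfo
    rw [Measure.map_const, measure_univ, one_smul, Measure.prod_dirac,
      Measure.map_map (by fun_prop) hY]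
    have := Measure.isProbabilityMeasure_map (μ := μ)
      (hY.prodMk (measurable_const (a := ()))).aemeasurable
    exact klDiv_self _
  rw [h0, zero_add] at h
  exact (mutualInfo_comp_le μ hY ((measurable_const (a := ())).prodMk hX) measurable_id
    measurable_snd).trans h

end MutualInfo

/-! ### The pulse and its matched filters -/

section AbsolutelyContinuous

lemma absolutelyContinuousOnInterval_comp_lipschitz {φ f : ℝ → ℝ} {L : ℝ≥0} {a b : ℝ}
    (hφ : LipschitzWith L φ) (hf : AbsolutelyContinuousOnInterval f a b) :
    AbsolutelyContinuousOnInterval (fun t => φ (f t)) a b := by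
  rw [absolutelyContinuousOnInterval_iff] at hf ⊢
  intro ε hε
  obtain ⟨δ, hδ, h⟩ := hf (ε / (L + 1)) (by positivity)
  refine ⟨δ, hδ, fun I hI hlen => ?_⟩
  calc ∑ i ∈ Finset.range I.1, dist (φ (f (I.2 i).1)) (φ (f (I.2 i).2))
      ≤ ∑ i ∈ Finset.range I.1, (L + 1) * dist (f (I.2 i).1) (f (I.2 i).2) := by
        refine Finset.sum_le_sum fun i _ => (hφ.dist_le_mul _ _).trans ?_
        gcongr
        linarith
    _ = (L + 1) * ∑ i ∈ Finset.range I.1, dist (f (I.2 i).1) (f (I.2 i).2) := by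
        rw [Finset.mul_sum]
    _ < (L + 1) * (ε / (L + 1)) := by
        gcongr
        exact h I hI hlen
    _ = ε := by field_simp

/-- Change of variables by an indefinite Lebesgue integral. -/
lemma integral_mul_comp_integral {w : ℝ → ℝ} (hw : LocallyIntegrable w) {φ ψ : ℝ → ℝ} {L : ℝ≥0}
    (hφ : LipschitzWith L φ) (hψ : ∀ u, HasDerivAt φ (ψ u) u) (a b : ℝ) :
    ∫ t in a..b, w t * ψ (∫ s in a..t, w s) = φ (∫ s in a..b, w s) - φ 0 := by
  have hwi : IntervalIntegrable w volume a b :=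
    (hw.integrableOn_isCompact isCompact_uIcc).intervalIntegrable
  have hac := absolutelyContinuousOnInterval_comp_lipschitz hφ
    (hwi.absolutelyContinuousOnInterval_intervalIntegral (c := a) (by simp))
  have h := hac.integral_deriv_eq_sub
  rw [intervalIntegral.integral_same] at h
  rw [← h]
  refine intervalIntegral.integral_congr_ae ?_
  filter_upwards [_root_.LocallyIntegrable.ae_hasDerivAt_integral hw] with t ht _
  rw [HasDerivAt.deriv (f := fun t => φ (∫ s in a..t, w s)) ((hψ _).comp t (ht a)), mul_comm]

end AbsolutelyContinuous

/-- At integer frequency shifts exactly one filter responds. -/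
lemma gain_int (v f : ℤ) : gain v f = if f = v then 1 else 0 := by
  unfold gain
  by_cases h : f = v
  · simp [h]
  · have h' : ((v : ℤ) : ℝ) ≠ f := by exact_mod_cast Ne.symm h
    rw [if_neg h', if_neg h]
    have : Complex.exp (Complex.I * (2 * Real.pi * (((v : ℤ) : ℝ) - f) : ℝ)) = 1 := by
      rw [Complex.exp_eq_one_iff]
      exact ⟨v - f, by push_cast; ring⟩
    rw [this]
    simp

namespace Pulse

variable (g : Pulse)

lemma integrable_sq : Integrable (fun t => ‖g.p t‖ ^ 2) := g.memLp.integrable_norm_pow (by simp)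

lemma continuous_K : Continuous g.K :=
  continuous_const.mul (intervalIntegral.continuous_primitive
    (fun _ _ => g.integrable_sq.intervalIntegrable) 0)

lemma integral_sq_mul_comp_K {φ ψ : ℝ → ℝ} {L : ℝ≥0} (hφ : LipschitzWith L φ)
    (hψ : ∀ u, HasDerivAt φ (ψ u) u) :
    ∫ t in (0 : ℝ)..g.Ts, ‖g.p t‖ ^ 2 * ψ (g.K t) = g.E * (φ 1 - φ 0) := by
  have hE := g.E_pos.ne'
  have h := integral_mul_comp_integral (w := fun t => 1 / g.E * ‖g.p t‖ ^ 2)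
    (g.integrable_sq.const_mul _).locallyIntegrable hφ hψ 0 g.Ts
  simp only [intervalIntegral.integral_const_mul] at h
  rw [g.energy, one_div, inv_mul_cancel₀ hE] at h
  rw [← h, ← intervalIntegral.integral_const_mul]
  refine intervalIntegral.integral_congr fun t _ => ?_
  simp only [K, one_div]
  field_simp

lemma lipschitzWith_sin_mul (a : ℝ) : LipschitzWith ‖a‖₊ fun u : ℝ => Real.sin (a * u) := by
  refine lipschitzWith_of_nnnorm_deriv_le (by fun_prop) fun u => ?_
  have h : HasDerivAt (fun u : ℝ => Real.sin (a * u)) (Real.cos (a * u) * (a * 1)) u :=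
    ((hasDerivAt_id u).const_mul a).sin
  rw [h.deriv, mul_one, nnnorm_mul]
  exact mul_le_of_le_one_left (by positivity) (Real.abs_cos_le_one _)

lemma lipschitzWith_cos_mul (a : ℝ) : LipschitzWith ‖a‖₊ fun u : ℝ => Real.cos (a * u) := by
  refine lipschitzWith_of_nnnorm_deriv_le (by fun_prop) fun u => ?_
  have h : HasDerivAt (fun u : ℝ => Real.cos (a * u)) (-Real.sin (a * u) * (a * 1)) u :=
    ((hasDerivAt_id u).const_mul a).cos
  rw [h.deriv, mul_one, nnnorm_mul, nnnorm_neg]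
  exact mul_le_of_le_one_left (by positivity) (Real.abs_sin_le_one _)

/-- The running energy `K` carries the measure `‖p‖² dt` to `E` times Lebesgue measure on `[0, 1]`,
and the gain is the integral of a complex exponential over `[0, 1]`. -/
lemma integral_sq_mul_exp (v : ℝ) (f : ℤ) :
    ∫ t : ℝ, (‖g.p t‖ ^ 2 : ℝ) * Complex.exp (Complex.I * (2 * Real.pi * (v - f) * g.K t : ℝ)) =
      g.E * gain v f := by
  have hsupp : ∫ t : ℝ, (‖g.p t‖ ^ 2 : ℝ) *
      Complex.exp (Complex.I * (2 * Real.pi * (v - f) * g.K t : ℝ)) =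
      ∫ t in (0 : ℝ)..g.Ts, (‖g.p t‖ ^ 2 : ℝ) *
        Complex.exp (Complex.I * (2 * Real.pi * (v - f) * g.K t : ℝ)) := by
    rw [intervalIntegral.integral_of_le g.Ts_pos.le, ← integral_Icc_eq_integral_Ioc,
      setIntegral_eq_integral_of_forall_compl_eq_zero]
    intro t ht
    simp [g.timeLimited t ht]
  rw [hsupp]
  by_cases hv : v = f
  · simp only [hv, sub_self, mul_zero, zero_mul, Complex.ofReal_zero, Complex.exp_zero, mul_one,
      gain, if_true]
    rw [intervalIntegral.integral_ofReal, g.energy]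
  set a := 2 * Real.pi * (v - f) with ha
  have ha0 : a ≠ 0 := by
    have := sub_ne_zero.2 hv
    positivity
  have hcos := g.integral_sq_mul_comp_K (lipschitzWith_sin_mul a)
    (ψ := fun u => a * Real.cos (a * u))
    fun u => by simpa [mul_comm] using ((hasDerivAt_id u).const_mul a).sin
  have hsin := g.integral_sq_mul_comp_K (lipschitzWith_cos_mul a)
    (ψ := fun u => a * -Real.sin (a * u))
    fun u => by simpa [mul_comm] using ((hasDerivAt_id u).const_mul a).cos
  have hint : ∀ φ : ℝ → ℝ, Continuous φ → IntervalIntegrable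
      (fun t => ((‖g.p t‖ ^ 2 * φ (g.K t) : ℝ) : ℂ)) volume 0 g.Ts := fun φ hφ => by
    have h := g.integrable_sq.intervalIntegrable.mul_continuousOn (a := 0) (b := g.Ts)
      (hφ.comp g.continuous_K).continuousOn
    exact ⟨h.1.ofReal, h.2.ofReal⟩
  have hsplit : ∀ t, ((‖g.p t‖ ^ 2 : ℝ) : ℂ) * Complex.exp (Complex.I * (a * g.K t : ℝ)) =
      (a : ℂ)⁻¹ * ((‖g.p t‖ ^ 2 * (a * Real.cos (a * g.K t)) : ℝ) : ℂ) - Complex.I * (a : ℂ)⁻¹ *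
        ((‖g.p t‖ ^ 2 * (a * -Real.sin (a * g.K t)) : ℝ) : ℂ) := by
    intro t
    have : (a : ℂ) ≠ 0 := by exact_mod_cast ha0
    rw [mul_comm Complex.I, Complex.exp_mul_I]
    push_cast
    field_simp
    ring
  simp only [hsplit]
  rw [intervalIntegral.integral_sub
    ((hint (fun u => a * Real.cos (a * u)) (by fun_prop)).const_mul _)
    ((hint (fun u => a * -Real.sin (a * u)) (by fun_prop)).const_mul _),
    intervalIntegral.integral_const_mul,
    intervalIntegral.integral_const_mul, intervalIntegral.integral_ofReal,
    intervalIntegral.integral_ofReal, hcos, hsin, gain, if_neg hv, ← ha, mul_comm Complex.I (a : ℂ),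
    Complex.exp_mul_I]
  have : (a : ℂ) ≠ 0 := by exact_mod_cast ha0
  push_cast
  simp only [mul_one, mul_zero, Complex.sin_zero, Complex.cos_zero]
  field_simp
  linear_combination (g.E * (1 - Complex.cos a)) * Complex.I_sq

/-- Pulses in different symbol slots overlap only in a null set. -/
lemma ae_shift_eq_zero : ∀ᵐ t : ℝ, ∀ m j : ℕ, m ≠ j →
    g.p (t - m * g.Ts) = 0 ∨ g.p (t - j * g.Ts) = 0 := by
  have hnull : ∀ᵐ t : ℝ, ∀ i : ℕ, t ≠ i * g.Ts :=
    ae_all_iff.2 fun i => by simp [ae_iff]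
  filter_upwards [hnull] with t ht m j hmj
  by_contra! h
  have hT := g.Ts_pos
  have hmem : ∀ i : ℕ, g.p (t - i * g.Ts) ≠ 0 → 0 ≤ t - i * g.Ts ∧ t - i * g.Ts ≤ g.Ts :=
    fun i hi => by
      by_contra hc
      exact hi (g.timeLimited _ hc)
  obtain ⟨hm0, hm1⟩ := hmem m h.1
  obtain ⟨hj0, hj1⟩ := hmem j h.2
  rcases Nat.lt_or_gt_of_ne hmj with hlt | hlt
  · have h1 : ((m : ℝ) + 1) * g.Ts ≤ j * g.Ts := by gcongr; exact_mod_cast hlt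
    exact ht j (by nlinarith)
  · have h1 : ((j : ℝ) + 1) * g.Ts ≤ m * g.Ts := by gcongr; exact_mod_cast hlt
    exact ht m (by nlinarith)

lemma filter_sub (f : ℤ) (s t : ℝ) : g.filter f (s - t) = (starRingEnd ℂ) (g.p (t - s)) *
    Complex.exp (-(Complex.I * (2 * Real.pi * f * g.K (t - s) : ℝ))) := by
  rw [filter, neg_sub]

/-- In slot `j` only one pulse of the field overlaps with the filter, and the integral reduces to
`integral_sq_mul_exp`. -/
lemma integral_field_mul_filter (c : Channel) {n : ℕ} (x : Fin 3 → Fin n → ℂ) (k : Fin 3)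
    (j : Fin n) (f : ℤ) :
    ∫ t : ℝ, g.field c x k t * g.filter f ((j : ℕ) * g.Ts - t) = g.E * c.clean x k j f := by
  obtain ⟨F, hF⟩ : ∃ F : ℝ → ℂ, F = fun s => x k j * Complex.exp (Complex.I * (c.Phi x k j : ℝ)) *
      ((‖g.p s‖ ^ 2 : ℝ) *
        Complex.exp (Complex.I * (2 * Real.pi * (c.V x k j - f) * g.K s : ℝ))) := ⟨_, rfl⟩
  have h1 : ∫ t : ℝ, g.field c x k t * g.filter f ((j : ℕ) * g.Ts - t) =
      ∫ t : ℝ, F (t - (j : ℕ) * g.Ts) := by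
    rw [hF]
    refine integral_congr_ae ?_
    filter_upwards [g.ae_shift_eq_zero] with t ht
    rw [field, Finset.sum_mul, Finset.sum_eq_single j, filter_sub]
    · have hexp : Complex.exp (Complex.I * (c.Phi x k j +
            2 * Real.pi * c.V x k j * g.K (t - (j : ℕ) * g.Ts) : ℝ)) *
          Complex.exp (-(Complex.I * (2 * Real.pi * f * g.K (t - (j : ℕ) * g.Ts) : ℝ))) =
          Complex.exp (Complex.I * (c.Phi x k j : ℝ)) * Complex.exp (Complex.I *
            (2 * Real.pi * (c.V x k j - f) * g.K (t - (j : ℕ) * g.Ts) : ℝ)) := by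
        rw [← Complex.exp_add, ← Complex.exp_add]
        congr 1
        push_cast
        ring
      have hsq : g.p (t - (j : ℕ) * g.Ts) * (starRingEnd ℂ) (g.p (t - (j : ℕ) * g.Ts)) =
          ((‖g.p (t - (j : ℕ) * g.Ts)‖ ^ 2 : ℝ) : ℂ) := by
        rw [Complex.mul_conj, Complex.normSq_eq_norm_sq]
      linear_combination (x k j * g.p (t - (j : ℕ) * g.Ts) *
        (starRingEnd ℂ) (g.p (t - (j : ℕ) * g.Ts))) * hexp + (x k j * Complex.exp (Complex.I *
        (c.Phi x k j : ℝ)) * Complex.exp (Complex.I *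
            (2 * Real.pi * (c.V x k j - f) * g.K (t - (j : ℕ) * g.Ts) : ℝ))) * hsq
    · intro m _ hm
      rw [filter_sub]
      rcases ht m j (fun h => hm (Fin.ext h)) with h | h <;> simp [h]
    · simp
  rw [h1, integral_sub_right_eq_self F, hF, integral_const_mul, integral_sq_mul_exp, Channel.clean]
  ring

lemma integral_filter_mul_conj_filter (j j' : ℕ) (f f' : ℤ) :
    ∫ t : ℝ, g.filter f (j * g.Ts - t) * (starRingEnd ℂ) (g.filter f' (j' * g.Ts - t)) =
      if j = j' ∧ f = f' then (g.E : ℂ) else 0 := by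
  by_cases hj : j = j'
  · subst hj
    obtain ⟨F, hF⟩ : ∃ F : ℝ → ℂ, F = fun s => (‖g.p s‖ ^ 2 : ℝ) *
        Complex.exp (Complex.I * (2 * Real.pi * (((f' : ℤ) : ℝ) - f) * g.K s : ℝ)) := ⟨_, rfl⟩
    have h1 : ∫ t : ℝ, g.filter f (j * g.Ts - t) * (starRingEnd ℂ) (g.filter f' (j * g.Ts - t)) =
        ∫ t : ℝ, F (t - j * g.Ts) := by
      rw [hF]
      congr 1
      funext t
      rw [filter_sub, filter_sub]
      set s := t - j * g.Ts
      have hexp : Complex.exp (-(Complex.I * (2 * Real.pi * f * g.K s : ℝ))) *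
          (starRingEnd ℂ) (Complex.exp (-(Complex.I * (2 * Real.pi * f' * g.K s : ℝ)))) =
          Complex.exp (Complex.I * (2 * Real.pi * (((f' : ℤ) : ℝ) - f) * g.K s : ℝ)) := by
        rw [← Complex.exp_conj, ← Complex.exp_add]
        congr 1
        simp only [map_neg, map_mul, Complex.conj_I, Complex.conj_ofReal]
        push_cast
        ring
      have hsq : g.p s * (starRingEnd ℂ) (g.p s) = ((‖g.p s‖ ^ 2 : ℝ) : ℂ) := by
        rw [Complex.mul_conj, Complex.normSq_eq_norm_sq]
      rw [map_mul, Complex.conj_conj]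
      linear_combination (g.p s * (starRingEnd ℂ) (g.p s)) * hexp + Complex.exp (Complex.I *
        (2 * Real.pi * (((f' : ℤ) : ℝ) - f) * g.K s : ℝ)) * hsq
    rw [h1, integral_sub_right_eq_self F, hF, integral_sq_mul_exp, gain_int]
    simp
  · rw [if_neg (by simp [hj]), ← integral_zero ℝ ℂ]
    refine integral_congr_ae ?_
    filter_upwards [g.ae_shift_eq_zero] with t ht
    rw [filter_sub, filter_sub]
    rcases ht j j' hj with h | h <;> simp [h]

end Pulse

/-! ### Interference focusing, locality and measurability of the channel -/

section Focusing

variable {a : Fin 3 → Fin 3 → ℚ}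

lemma pHat_pos (a : Fin 3 → Fin 3 → ℚ) (l : Fin 3) : 0 < pHat a l :=
  Nat.pos_of_ne_zero fun h => by
    obtain ⟨k, _, hk⟩ := Finset.lcm_eq_zero_iff.1 h
    exact (a k l).den_ne_zero hk

lemma exists_int_coeff_mul_pHat (a : Fin 3 → Fin 3 → ℚ) {k l : Fin 3} (hkl : k ≠ l) :
    ∃ z : ℤ, (a k l : ℝ) * pHat a l = z := by
  obtain ⟨m, hm⟩ : (a k l).den ∣ pHat a l := Finset.dvd_lcm (by simpa using hkl)
  refine ⟨(a k l).num * m, ?_⟩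
  have h := Rat.mul_den_eq_num (a k l)
  have h' : (a k l : ℝ) * ((a k l).den : ℝ) = (a k l).num := by exact_mod_cast h
  rw [hm]
  push_cast
  rw [← mul_assoc, h']

lemma zero_mem_allowedPowers (l : Fin 3) : 0 ∈ allowedPowers a l := ⟨0, by simp⟩

lemma power_mem_allowedPowers {n : ℕ} {x : Fin n → ℂ} {l : Fin 3}
    (hx : ∀ j, ‖x j‖ ^ 2 ∈ allowedPowers a l) (t : ℤ) : power x t ∈ allowedPowers a l := by
  unfold power
  split_ifs
  · exact hx _
  · exact zero_mem_allowedPowers l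

namespace Channel

lemma lead_le_lag (c : Channel) (k l : Fin 3) : c.lead k l ≤ c.lag k l := by
  unfold lead
  split_ifs <;> omega

variable {c : Channel} (ha : ∀ k l, k ≠ l → c.h k l = (a k l : ℝ))
include ha

/-- The cross-phase modulation caused by a power in `2π p̂_l ℕ` is a multiple of `2π`. -/
lemma exists_int_h_mul {k l : Fin 3} (hkl : k ≠ l) {p : ℝ} (hp : p ∈ allowedPowers a l) :
    ∃ z : ℤ, c.h k l * p = 2 * Real.pi * z := by
  obtain ⟨m, rfl⟩ := hp
  obtain ⟨z, hz⟩ := exists_int_coeff_mul_pHat a hkl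
  refine ⟨z * m, ?_⟩
  push_cast
  rw [ha k l hkl, ← hz]
  ring

lemma exists_int_shift {k l : Fin 3} (hkl : k ≠ l) {p p' : ℝ} (hp : p ∈ allowedPowers a l)
    (hp' : p' ∈ allowedPowers a l) : ∃ z : ℤ, c.h k l * (p - p') / (2 * Real.pi) = z := by
  obtain ⟨z, hz⟩ := exists_int_h_mul ha hkl hp
  obtain ⟨z', hz'⟩ := exists_int_h_mul ha hkl hp'
  refine ⟨z - z', ?_⟩
  have := Real.pi_ne_zero
  rw [mul_sub, hz, hz']
  push_cast
  field_simp

lemma exists_int_sum_shift (k : Fin 3) {p p' : Fin 3 → ℝ}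
    (hp : ∀ l, l ≠ k → p l ∈ allowedPowers a l) (hp' : ∀ l, l ≠ k → p' l ∈ allowedPowers a l) :
    ∃ z : ℤ, ∑ l ∈ Finset.univ.erase k, c.h k l * (p l - p' l) / (2 * Real.pi) = z := by
  have h : ∀ l, ∃ z : ℤ, l ≠ k → c.h k l * (p l - p' l) / (2 * Real.pi) = z := fun l => by
    by_cases hl : l = k
    · exact ⟨0, fun h => absurd hl h⟩
    · obtain ⟨z, hz⟩ := exists_int_shift ha (Ne.symm hl) (hp l hl) (hp' l hl)
      exact ⟨z, fun _ => hz⟩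
  choose z hz using h
  refine ⟨∑ l ∈ Finset.univ.erase k, z l, ?_⟩
  push_cast
  exact Finset.sum_congr rfl fun l hl => hz l (Finset.ne_of_mem_erase hl)

lemma exists_int_V_eq {n : ℕ} {x : Fin 3 → Fin n → ℂ}
    (hx : ∀ l j, ‖x l j‖ ^ 2 ∈ allowedPowers a l) (k : Fin 3) (j : Fin n) :
    ∃ v : ℤ, c.V x k j = v :=
  exists_int_sum_shift ha k (fun l _ => power_mem_allowedPowers (hx l) _)
    fun l _ => power_mem_allowedPowers (hx l) _

/-- The cross-phase modulation drops out of the phase factor. -/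
lemma exp_Phi {n : ℕ} {x : Fin 3 → Fin n → ℂ}
    (hx : ∀ l j, ‖x l j‖ ^ 2 ∈ allowedPowers a l) (k : Fin 3) (j : Fin n) :
    Complex.exp (Complex.I * (c.Phi x k j : ℝ)) =
      Complex.exp (Complex.I * (c.h k k * ‖x k j‖ ^ 2 : ℝ)) := by
  have h : ∀ l, ∃ z : ℤ, l ≠ k → c.h k l * ∑ r ∈ Finset.Icc 1 (c.lag k l),
      power (x l) ((j : ℤ) + c.lead k l - r) = 2 * Real.pi * z := fun l => by
    by_cases hl : l = k
    · exact ⟨0, fun h => absurd hl h⟩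
    · choose z hz using fun r : ℕ => exists_int_h_mul ha (Ne.symm hl)
        (power_mem_allowedPowers (hx l) ((j : ℤ) + c.lead k l - r))
      refine ⟨∑ r ∈ Finset.Icc 1 (c.lag k l), z r, fun _ => ?_⟩
      push_cast
      rw [Finset.mul_sum, Finset.mul_sum]
      exact Finset.sum_congr rfl fun r _ => hz r
  choose z hz using h
  rw [Complex.exp_eq_exp_iff_exists_int]
  refine ⟨∑ l ∈ Finset.univ.erase k, z l, ?_⟩
  rw [Phi, Finset.sum_congr rfl fun l hl => hz l (Finset.ne_of_mem_erase hl)]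
  push_cast
  rw [mul_add, Finset.mul_sum, Finset.sum_mul]
  congr 1
  exact Finset.sum_congr rfl fun l _ => by ring

/-- The symbol `x` after self-phase modulation at receiver `k`. -/
def spm (c : Channel) (k : Fin 3) (x : ℂ) : ℂ :=
  x * Complex.exp (Complex.I * (c.h k k * ‖x‖ ^ 2 : ℝ))

lemma clean_eq_ite {n : ℕ} {x : Fin 3 → Fin n → ℂ}
    (hx : ∀ l j, ‖x l j‖ ^ 2 ∈ allowedPowers a l) (k : Fin 3) (j : Fin n) {v : ℤ}
    (hv : c.V x k j = v) (f : ℤ) :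
    c.clean x k j f = if f = v then c.spm k (x k j) else 0 := by
  rw [clean, hv, gain_int, exp_Phi ha hx, spm]
  split_ifs <;> simp

omit ha in
/-- Symbols outside the codewords have power `0`, which need not be in `W`; this is why `Interior`
is needed. -/
lemma mem_focusBank {W : Fin 3 → Finset ℝ} {n : ℕ} {x : Fin 3 → Fin n → ℂ}
    (hx : ∀ l j, ‖x l j‖ ^ 2 ∈ W l) {k : Fin 3} {j : Fin n} {v : ℤ} (hv : c.V x k j = v)
    (hj : c.Interior n k j) : v ∈ c.focusBank W k := by
  have hpow : ∀ l, ∀ t : ℤ, 0 ≤ t ∧ t < n → power (x l) t ∈ W l := fun l t ht => by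
    rw [power, dif_pos ht]
    exact hx _ _
  rw [focusBank, Finset.mem_preimage, shifts, Finset.mem_image]
  refine ⟨fun l => if l = k then (‖x k j‖ ^ 2, ‖x k j‖ ^ 2) else
    (power (x l) ((j : ℤ) + c.lead k l), power (x l) ((j : ℤ) + c.lead k l - c.lag k l)), ?_, ?_⟩
  · refine Fintype.mem_piFinset.2 fun l => ?_
    have := c.lead_le_lag k l
    split_ifs with hl
    · subst hl
      exact Finset.mem_product.2 ⟨hx _ _, hx _ _⟩
    · obtain ⟨h0, h1⟩ := hj l hl
      exact Finset.mem_product.2 ⟨hpow _ _ ⟨by omega, by omega⟩, hpow _ _ ⟨h0, by omega⟩⟩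
  · rw [← hv, V]
    refine Finset.sum_congr rfl fun l hl => ?_
    beta_reduce
    rw [if_neg (Finset.ne_of_mem_erase hl)]

omit ha in
lemma output_eq {n : ℕ} (x : Fin 3 → Fin n → ℂ) (z : Noise n) (k : Fin 3) (j : Fin n) (f : ℤ) :
    c.output x z k j f = c.clean x k j f + z (k, j, f) := rfl

end Channel

/-- Interference focusing, as an assertion about single codewords. -/
lemma Channel.focusing {c : Channel} (ha : ∀ k l, k ≠ l → c.h k l = (a k l : ℝ))
    (W : Fin 3 → Finset ℝ) (hW : ∀ l, (W l : Set ℝ) ⊆ allowedPowers a l) :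
    (∀ k, ∀ v ∈ c.shifts W k, ∃ f : ℤ, v = f) ∧
      ∀ (n : ℕ) (x : Fin 3 → Fin n → ℂ), (∀ l j, ‖x l j‖ ^ 2 ∈ W l) →
        ∀ (k : Fin 3) (j : Fin n), ∃ v : ℤ, c.V x k j = v ∧
          (∀ (z : Noise n) (f : ℤ), c.output x z k j f =
            (if f = v then x k j * Complex.exp (Complex.I * (c.h k k * ‖x k j‖ ^ 2 : ℝ)) else 0)
              + z (k, j, f)) ∧
          (c.Interior n k j → v ∈ c.focusBank W k) := by
  refine ⟨fun k v hv => ?_, fun n x hx k j => ?_⟩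
  · obtain ⟨d, hd, rfl⟩ := Finset.mem_image.1 hv
    have hd' := fun l => Finset.mem_product.1 (Fintype.mem_piFinset.1 hd l)
    exact exists_int_sum_shift ha k (fun l _ => hW l (hd' l).1) fun l _ => hW l (hd' l).2
  · have hx' : ∀ l j, ‖x l j‖ ^ 2 ∈ allowedPowers a l := fun l j => hW l (hx l j)
    obtain ⟨v, hv⟩ := exists_int_V_eq ha hx' k j
    exact ⟨v, hv, fun z f => by rw [output, clean_eq_ite ha hx' k j hv, spm],
      mem_focusBank hx hv⟩

end Focusing

section Locality

lemma power_append_of_lt {m n : ℕ} (x : Fin m → ℂ) (y : Fin n → ℂ) {t : ℤ} (ht : t < m) :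
    power (Fin.append x y) t = power x t := by
  unfold power
  by_cases h0 : 0 ≤ t
  · rw [dif_pos ⟨h0, by push_cast; omega⟩, dif_pos ⟨h0, ht⟩]
    have : (⟨t.toNat, by omega⟩ : Fin (m + n)) = Fin.castAdd n ⟨t.toNat, by omega⟩ := rfl
    rw [this, Fin.append_left]
  · rw [dif_neg (by omega), dif_neg (by omega)]

lemma power_append_of_ge {m n : ℕ} (x : Fin m → ℂ) (y : Fin n → ℂ) {t : ℤ} (ht : (m : ℤ) ≤ t) :
    power (Fin.append x y) t = power y (t - m) := by
  unfold power
  by_cases h0 : t < (m + n : ℕ)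
  · rw [dif_pos ⟨by omega, h0⟩, dif_pos ⟨by omega, by push_cast at h0; omega⟩]
    have : (⟨t.toNat, by omega⟩ : Fin (m + n)) =
        Fin.natAdd m ⟨(t - m).toNat, by push_cast at h0; omega⟩ := by
      ext
      simp
      omega
    rw [this, Fin.append_right]
  · rw [dif_neg (by omega), dif_neg (by push_cast at h0; omega)]

namespace Channel

variable (c : Channel)

/-- A bound for the walk-off lengths at receiver `k`. -/
def reach (k : Fin 3) : ℕ := Finset.univ.sup (c.lag k)

lemma lag_le_reach (k l : Fin 3) : c.lag k l ≤ c.reach k := Finset.le_sup (Finset.mem_univ l)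

lemma interior_of_reach {n : ℕ} {k : Fin 3} {j : Fin n} (h0 : c.reach k ≤ j)
    (h1 : (j : ℕ) + c.reach k < n) : c.Interior n k j := by
  intro l _
  have := c.lag_le_reach k l
  have := c.lead_le_lag k l
  omega

lemma clean_append_left {m n : ℕ} (x : Fin 3 → Fin m → ℂ) (y : Fin 3 → Fin n → ℂ) (k : Fin 3)
    (j : Fin m) (hj : (j : ℕ) + c.reach k < m) (f : ℤ) :
    c.clean (fun l => Fin.append (x l) (y l)) k (Fin.castAdd n j) f = c.clean x k j f := by
  have hlag := c.lag_le_reach k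
  have hlead := c.lead_le_lag k
  have hPhi : c.Phi (fun l => Fin.append (x l) (y l)) k (Fin.castAdd n j) = c.Phi x k j := by
    unfold Phi
    beta_reduce
    rw [Fin.append_left]
    congr 1
    refine Finset.sum_congr rfl fun l _ => ?_
    congr 1
    refine Finset.sum_congr rfl fun r _ => power_append_of_lt _ _ ?_
    have := hlag l
    have := hlead l
    simp only [Fin.val_castAdd]
    omega
  have hV : c.V (fun l => Fin.append (x l) (y l)) k (Fin.castAdd n j) = c.V x k j := by
    unfold V
    refine Finset.sum_congr rfl fun l _ => ?_
    have := hlag l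
    have := hlead l
    rw [power_append_of_lt _ _ (by simp only [Fin.val_castAdd]; omega),
      power_append_of_lt _ _ (by simp only [Fin.val_castAdd]; omega)]
    rfl
  rw [clean, clean, hPhi, hV, Fin.append_left]

lemma clean_append_right {m n : ℕ} (x : Fin 3 → Fin m → ℂ) (y : Fin 3 → Fin n → ℂ) (k : Fin 3)
    (j : Fin n) (hj : c.reach k ≤ (j : ℕ)) (f : ℤ) :
    c.clean (fun l => Fin.append (x l) (y l)) k (Fin.natAdd m j) f = c.clean y k j f := by
  have hlag := c.lag_le_reach k
  have hlead := c.lead_le_lag k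
  have hPhi : c.Phi (fun l => Fin.append (x l) (y l)) k (Fin.natAdd m j) = c.Phi y k j := by
    unfold Phi
    beta_reduce
    rw [Fin.append_right]
    congr 1
    refine Finset.sum_congr rfl fun l _ => ?_
    congr 1
    refine Finset.sum_congr rfl fun r hr => ?_
    have := hlag l
    have := hlead l
    have := (Finset.mem_Icc.1 hr).2
    rw [power_append_of_ge _ _ (by simp only [Fin.val_natAdd]; push_cast; omega)]
    congr 1
    simp only [Fin.val_natAdd]
    push_cast
    ring
  have hV : c.V (fun l => Fin.append (x l) (y l)) k (Fin.natAdd m j) = c.V y k j := by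
    unfold V
    refine Finset.sum_congr rfl fun l _ => ?_
    have := hlag l
    have := hlead l
    rw [power_append_of_ge _ _ (by simp only [Fin.val_natAdd]; push_cast; omega),
      power_append_of_ge _ _ (by simp only [Fin.val_natAdd]; push_cast; omega)]
    rw [show (((Fin.natAdd m j : Fin (m + n)) : ℕ) : ℤ) + c.lead k l - m = j + c.lead k l by
        simp only [Fin.val_natAdd]; push_cast; ring,
      show (((Fin.natAdd m j : Fin (m + n)) : ℕ) : ℤ) + c.lead k l - c.lag k l - m =
        j + c.lead k l - c.lag k l by simp only [Fin.val_natAdd]; push_cast; ring]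
  rw [clean, clean, hPhi, hV, Fin.append_right]

end Channel

end Locality

section Measurability

@[fun_prop]
lemma measurable_power {n : ℕ} (t : ℤ) : Measurable fun x : Fin n → ℂ => power x t := by
  unfold power
  split_ifs <;> fun_prop

@[fun_prop]
lemma measurable_gain (f : ℤ) : Measurable fun v : ℝ => gain v f := by
  unfold gain
  exact Measurable.ite (measurableSet_singleton _) (by fun_prop) (by fun_prop)

namespace Channel

variable (c : Channel) {n : ℕ} (k : Fin 3) (j : Fin n)

@[fun_prop]
lemma measurable_V : Measurable fun x : Fin 3 → Fin n → ℂ => c.V x k j := by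
  unfold V
  refine Finset.measurable_sum _ fun l _ => ?_
  have h : ∀ t : ℤ, Measurable fun x : Fin 3 → Fin n → ℂ => power (x l) t :=
    fun t => (measurable_power t).comp (measurable_pi_apply l)
  exact (((h _).sub (h _)).const_mul _).div_const _

@[fun_prop]
lemma measurable_Phi : Measurable fun x : Fin 3 → Fin n → ℂ => c.Phi x k j := by
  unfold Phi
  refine Measurable.add (by fun_prop) (Finset.measurable_sum _ fun l _ => ?_)
  exact (Finset.measurable_sum _ fun r _ =>
    (measurable_power (n := n) _).comp (measurable_pi_apply l)).const_mul _

@[fun_prop]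
lemma measurable_clean (f : ℤ) : Measurable fun x : Fin 3 → Fin n → ℂ => c.clean x k j f := by
  unfold clean
  have h := (measurable_gain f).comp (c.measurable_V k j)
  exact Measurable.mul (by fun_prop) h

end Channel

end Measurability

/-! ### Laws of the noise and of blocks of i.i.d. inputs -/

section Reindexing

variable {ι κ X : Type*} [Fintype ι] [Fintype κ] [MeasurableSpace X]

lemma pi_pi_eq_map_curry (μ : ι → κ → Measure X) [∀ i j, IsProbabilityMeasure (μ i j)] :
    Measure.pi (fun i => Measure.pi (μ i)) =
      (Measure.pi fun p : ι × κ => μ p.1 p.2).map (MeasurableEquiv.curry ι κ X) := by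
  simp only [← Measure.infinitePi_eq_pi]
  exact (Measure.infinitePi_map_curry μ).symm

lemma measurePreserving_pi_swap (μ : ι → κ → Measure X) [∀ i j, IsProbabilityMeasure (μ i j)] :
    MeasurePreserving (fun (x : ι → κ → X) j i => x i j) (Measure.pi fun i => Measure.pi (μ i))
      (Measure.pi fun j => Measure.pi fun i => μ i j) := by
  refine ⟨by fun_prop, ?_⟩
  rw [pi_pi_eq_map_curry, pi_pi_eq_map_curry, Measure.map_map (by fun_prop) (by fun_prop)]
  have h : (Measure.pi fun p : κ × ι => μ p.2 p.1) =
      (Measure.pi fun p : ι × κ => μ p.1 p.2).map (fun x p => x p.swap) := by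
    simp only [← Measure.infinitePi_eq_pi]
    exact (Measure.map_infinitePi_infinitePi_of_inj (P := fun p : ι × κ => μ p.1 p.2)
      (f := (Prod.swap : κ × ι → ι × κ)) Prod.swap_injective).symm
  rw [h, Measure.map_map (by fun_prop) (by fun_prop)]
  rfl

end Reindexing

instance (N : ℝ) {n : ℕ} (Q : Fin 3 → Measure (Fin n → ℂ)) [∀ k, IsProbabilityMeasure (Q k)] :
    IsProbabilityMeasure (blockLaw N Q) := by
  unfold blockLaw
  infer_instance

/-- Picking one filter per symbol, the choice depending on the inputs only, leaves noise that is
i.i.d. and independent of the inputs. -/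
lemma measurePreserving_select_noise (N : ℝ) {n : ℕ} (Q : Fin 3 → Measure (Fin n → ℂ))
    [∀ l, IsProbabilityMeasure (Q l)] (k : Fin 3) {v : (Fin 3 → Fin n → ℂ) → Fin n → ℤ}
    (hv : ∀ j, Measurable fun x => v x j) :
    MeasurePreserving (fun ω : (Fin 3 → Fin n → ℂ) × Noise n =>
        (ω.1, fun j => ω.2 (k, j, v ω.1 j)))
      (blockLaw N Q) ((Measure.pi Q).prod (Measure.pi fun _ => cgauss N)) := by
  have hmeas : Measurable (Function.uncurry fun (x : Fin 3 → Fin n → ℂ) (z : Noise n) (j : Fin n) =>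
      z (k, j, v x j)) := by
    refine measurable_pi_lambda _ fun j => ?_
    have h : Measurable fun p : ℤ × Noise n => p.2 (k, j, p.1) :=
      measurable_from_prod_countable_right fun f => by
        change Measurable fun z : Noise n => z (k, j, f)
        fun_prop
    exact h.comp (((hv j).comp measurable_fst).prodMk measurable_snd)
  refine MeasurePreserving.skew_product (MeasurePreserving.id _) hmeas (ae_of_all _ fun x => ?_)
  have h := Measure.map_infinitePi_infinitePi_of_inj
    (P := fun _ : Fin 3 × Fin n × ℤ => cgauss N) (f := fun j : Fin n => (k, j, v x j))
    fun i j hij => (Prod.ext_iff.1 (Prod.ext_iff.1 hij).2).1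
  rw [Measure.infinitePi_eq_pi (ι := Fin n)] at h
  exact h

/-- The selected branch has neither interference nor a gain, and its index depends only on the
inputs, so `measurePreserving_select_noise` applies. -/
lemma map_selected_branch {c : Channel} {a : Fin 3 → Fin 3 → ℚ}
    (ha : ∀ k l, k ≠ l → c.h k l = (a k l : ℝ)) (N : ℝ) {n : ℕ}
    (Q : Fin 3 → Measure (Fin n → ℂ)) (hQ : ∀ l, IsProbabilityMeasure (Q l))
    (hpow : ∀ l, ∀ᵐ x ∂(Q l), ∀ j, ‖x j‖ ^ 2 ∈ allowedPowers a l) (k : Fin 3) :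
    (blockLaw N Q).map
        (fun ω => (ω.1 k, fun j : Fin n => c.output ω.1 ω.2 k j ⌊c.V ω.1 k j⌋)) =
      ((Q k).prod (Measure.pi fun _ : Fin n => cgauss N)).map
        (fun ω => (ω.1, fun j : Fin n =>
          ω.1 j * Complex.exp (Complex.I * (c.h k k * ‖ω.1 j‖ ^ 2 : ℝ)) + ω.2 j)) := by
  have hae : ∀ᵐ x ∂(Measure.pi Q), ∀ l j, ‖x l j‖ ^ 2 ∈ allowedPowers a l :=
    ae_all_iff.2 fun l => (Measure.quasiMeasurePreserving_eval Q l).ae (hpow l)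
  have hsel := measurePreserving_select_noise N Q k (v := fun x j => ⌊c.V x k j⌋)
    fun j => Int.measurable_floor.comp (c.measurable_V k j)
  have hk : MeasurePreserving (fun p : (Fin 3 → Fin n → ℂ) × (Fin n → ℂ) => (p.1 k, p.2))
      ((Measure.pi Q).prod (Measure.pi fun _ => cgauss N))
      ((Q k).prod (Measure.pi fun _ => cgauss N)) :=
    (measurePreserving_eval Q k).prod (MeasurePreserving.id _)
  rw [← (hk.comp hsel).map_eq, Measure.map_map (by fun_prop) (hk.comp hsel).measurable]
  refine Measure.map_congr ?_
  have hae' : ∀ᵐ ω ∂(blockLaw N Q), ∀ l j, ‖ω.1 l j‖ ^ 2 ∈ allowedPowers a l :=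
    Measure.quasiMeasurePreserving_fst.ae hae
  filter_upwards [hae'] with ω hω
  refine Prod.ext rfl (funext fun j => ?_)
  obtain ⟨v, hv⟩ := Channel.exists_int_V_eq ha hω k j
  simp only [Channel.output_eq, Function.comp_apply, Channel.clean_eq_ite ha hω k j hv, hv,
    Int.floor_intCast, if_true, Channel.spm]

section Slots

/-- What happens in one symbol slot at a fixed receiver with bank `F`: the symbols of the three
users and the noise samples of the filters in the bank. -/
abbrev Slot (F : Finset ℤ) : Type := (Fin 3 → ℂ) × (F → ℂ)

/-- The law of a slot: independent symbols with laws `ρ l`, and i.i.d. noise. -/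
def slotLaw (N : ℝ) (ρ : Fin 3 → Measure ℂ) (F : Finset ℤ) : Measure (Slot F) :=
  (Measure.pi ρ).prod (Measure.pi fun _ : F => cgauss N)

variable (N : ℝ) (ρ : Fin 3 → Measure ℂ) [∀ l, IsProbabilityMeasure (ρ l)] (F : Finset ℤ)

instance : IsProbabilityMeasure (slotLaw N ρ F) := by
  unfold slotLaw
  infer_instance

variable {F} {n : ℕ}

/-- The codewords of the three users. -/
def symbols (ω : Fin n → Slot F) : Fin 3 → Fin n → ℂ := fun l j => (ω j).1 l

/-- The codeword of user `k`. -/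
def sent (k : Fin 3) (ω : Fin n → Slot F) : Fin n → ℂ := fun j => (ω j).1 k

/-- The outputs of the bank of receiver `k`. -/
def Channel.received (c : Channel) (k : Fin 3) (ω : Fin n → Slot F) : Fin n → F → ℂ :=
  fun j f => c.clean (symbols ω) k j f + (ω j).2 f

@[fun_prop]
lemma measurable_symbols : Measurable (symbols : (Fin n → Slot F) → _) := by
  unfold symbols
  fun_prop

@[fun_prop]
lemma measurable_sent (k : Fin 3) : Measurable (sent k : (Fin n → Slot F) → _) := by
  unfold sent
  fun_prop

@[fun_prop]
lemma Channel.measurable_received (c : Channel) (k : Fin 3) :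
    Measurable (c.received k : (Fin n → Slot F) → _) := by
  unfold Channel.received
  refine measurable_pi_lambda _ fun j => measurable_pi_lambda _ fun f => ?_
  exact ((c.measurable_clean k j f).comp measurable_symbols).add (by fun_prop)

variable (F n) in
/-- Seen from one receiver, a block of i.i.d. inputs and its noise is a sequence of i.i.d. slots. -/
lemma map_blockLaw_slots (k : Fin 3) :
    (blockLaw N fun l => Measure.pi fun _ : Fin n => ρ l).map
        (fun ω j => (fun l => ω.1 l j, fun f : F => ω.2 (k, j, f))) =
      Measure.pi fun _ : Fin n => slotLaw N ρ F := by
  have hx := measurePreserving_pi_swap (fun (l : Fin 3) (_ : Fin n) => ρ l)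
  have hz : MeasurePreserving (fun (z : Noise n) (j : Fin n) (f : F) => z (k, j, f))
      (Measure.infinitePi fun _ : Fin 3 × Fin n × ℤ => cgauss N)
      (Measure.pi fun _ : Fin n => Measure.pi fun _ : F => cgauss N) := by
    refine ⟨by fun_prop, ?_⟩
    have h := Measure.map_infinitePi_infinitePi_of_inj
      (P := fun _ : Fin 3 × Fin n × ℤ => cgauss N)
      (f := fun p : Fin n × F => (k, p.1, (p.2 : ℤ)))
      fun p q hpq => by
        simp only [Prod.mk.injEq, true_and] at hpq
        exact Prod.ext hpq.1 (Subtype.ext hpq.2)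
    rw [Measure.infinitePi_eq_pi (ι := Fin n × F)] at h
    rw [pi_pi_eq_map_curry (fun (_ : Fin n) (_ : F) => cgauss N), ← h,
      Measure.map_map (by fun_prop) (by fun_prop)]
    rfl
  have hs := (measurePreserving_arrowProdEquivProdArrow (Fin 3 → ℂ) (F → ℂ) (Fin n)
    (fun _ => Measure.pi ρ) (fun _ => Measure.pi fun _ : F => cgauss N)).symm
  exact (hs.comp (hx.prod hz)).map_eq

lemma Channel.blockInfo_eq (c : Channel) (k : Fin 3) :
    c.blockInfo N (fun l => Measure.pi fun _ : Fin n => ρ l) F k =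
      mutualInfo (Measure.pi fun _ : Fin n => slotLaw N ρ F) (sent k) (c.received k) := by
  rw [← map_blockLaw_slots N ρ F n k, mutualInfo_map _ (by fun_prop) (by fun_prop) (by fun_prop)]
  rfl

lemma measurable_fin_append {m n : ℕ} {α : Type*} [MeasurableSpace α] :
    Measurable fun p : (Fin m → α) × (Fin n → α) => Fin.append p.1 p.2 := by
  refine measurable_pi_lambda _ fun j => ?_
  refine Fin.addCases (fun i => ?_) (fun i => ?_) j
  · simp only [Fin.append_left]
    fun_prop
  · simp only [Fin.append_right]
    fun_prop

lemma measurePreserving_append {α : Type*} [MeasurableSpace α] (τ : Measure α)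
    [IsProbabilityMeasure τ] (m n : ℕ) :
    MeasurePreserving (fun ω : (Fin m → α) × (Fin n → α) => Fin.append ω.1 ω.2)
      ((Measure.pi fun _ => τ).prod (Measure.pi fun _ => τ)) (Measure.pi fun _ => τ) := by
  refine ⟨measurable_fin_append, (Measure.pi_eq fun s hs => ?_).symm⟩
  have hpre : (fun ω : (Fin m → α) × (Fin n → α) => Fin.append ω.1 ω.2) ⁻¹' Set.univ.pi s =
      (Set.univ.pi fun i => s (Fin.castAdd n i)) ×ˢ (Set.univ.pi fun i => s (Fin.natAdd m i)) := by
    ext ω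
    simp [Set.mem_pi, Fin.forall_fin_add]
  rw [Measure.map_apply measurable_fin_append (MeasurableSet.univ_pi hs), hpre, Measure.prod_prod,
    Measure.pi_pi, Measure.pi_pi, Fin.prod_univ_add]

end Slots

/-! ### Existence of the information rates -/

section Rate

variable {F : Finset ℤ} {m n : ℕ}

/-- The mutual information over a block of length `n` with i.i.d. inputs. -/
def slotInfo (c : Channel) (N : ℝ) (ρ : Fin 3 → Measure ℂ) (F : Finset ℤ) (k : Fin 3) (n : ℕ) :
    ℝ≥0∞ :=
  mutualInfo (Measure.pi fun _ : Fin n => slotLaw N ρ F) (sent k) (c.received k)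

lemma sent_append (k : Fin 3) (ω : Fin m → Slot F) (ω' : Fin n → Slot F) :
    sent k (Fin.append ω ω') = Fin.append (sent k ω) (sent k ω') := by
  funext j
  refine Fin.addCases (fun i => ?_) (fun i => ?_) j <;> simp [sent]

lemma symbols_append (ω : Fin m → Slot F) (ω' : Fin n → Slot F) :
    symbols (Fin.append ω ω') = fun l => Fin.append (symbols ω l) (symbols ω' l) := by
  funext l j
  refine Fin.addCases (fun i => ?_) (fun i => ?_) j <;> simp [symbols]

namespace Channel

variable (c : Channel) (k : Fin 3)

/-- The change in the received signal when two blocks are sent in immediate succession instead of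
separately. -/
def junction (ω : (Fin m → Slot F) × (Fin n → Slot F)) : Fin (m + n) → F → ℂ :=
  c.received k (Fin.append ω.1 ω.2) - Fin.append (c.received k ω.1) (c.received k ω.2)

lemma measurable_junction :
    Measurable (c.junction k : (Fin m → Slot F) × (Fin n → Slot F) → _) := by
  unfold junction
  exact ((c.measurable_received k).comp measurable_fin_append).sub
    (measurable_fin_append.comp
      (((c.measurable_received k).comp measurable_fst).prodMk
        ((c.measurable_received k).comp measurable_snd)))

/-- The noiseless filter outputs in one slot, if user `k` uses the constellation `A` and frequency
shifts are integers: the signal is in one branch of the bank, or in none. -/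
def branchSignals (A : Finset ℂ) (F : Finset ℤ) : Finset (F → ℂ) :=
  insert 0 ((A ×ˢ F).image fun p f => if (f : ℤ) = p.2 then c.spm k p.1 else 0)

variable {a : Fin 3 → Fin 3 → ℚ} {A : Fin 3 → Finset ℂ}
  (hA : ∀ l, ∀ x ∈ A l, ‖x‖ ^ 2 ∈ allowedPowers a l)
include hA

lemma clean_mem_branchSignals {c : Channel} (ha : ∀ k l, k ≠ l → c.h k l = (a k l : ℝ))
    {x : Fin 3 → Fin n → ℂ}
    (hx : ∀ l j, x l j ∈ A l) (k : Fin 3) (j : Fin n) :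
    (fun f : F => c.clean x k j f) ∈ c.branchSignals k (A k) F := by
  have hx' : ∀ l j, ‖x l j‖ ^ 2 ∈ allowedPowers a l := fun l j => hA l _ (hx l j)
  obtain ⟨v, hv⟩ := exists_int_V_eq ha hx' k j
  simp only [clean_eq_ite ha hx' k j hv]
  by_cases hvF : v ∈ F
  · exact Finset.mem_insert_of_mem (Finset.mem_image.2 ⟨(x k j, v), by simp [hx, hvF], rfl⟩)
  · refine Finset.mem_insert.2 (Or.inl (funext fun f => if_neg ?_))
    rintro rfl
    exact hvF f.2

open Classical in
omit hA in
/-- The values that the junction can take: they vanish except near the junction. -/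
def junctionValues (A : Finset ℂ) (F : Finset ℤ) (m n : ℕ) : Finset (Fin (m + n) → F → ℂ) :=
  Fintype.piFinset fun j => if m ≤ (j : ℕ) + c.reach k ∧ (j : ℕ) < m + c.reach k then
    (c.branchSignals k A F ×ˢ c.branchSignals k A F).image fun p => p.1 - p.2 else {0}

lemma junction_mem_junctionValues {c : Channel} (ha : ∀ k l, k ≠ l → c.h k l = (a k l : ℝ))
    (k : Fin 3) {ω : (Fin m → Slot F) × (Fin n → Slot F)} (h1 : ∀ l j, symbols ω.1 l j ∈ A l)
    (h2 : ∀ l j, symbols ω.2 l j ∈ A l) :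
    c.junction k ω ∈ c.junctionValues k (A k) F m n := by
  classical
  have h12 : ∀ l j, Fin.append (symbols ω.1 l) (symbols ω.2 l) j ∈ A l := fun l j => by
    refine Fin.addCases (fun i => ?_) (fun i => ?_) j
    · rw [Fin.append_left]
      exact h1 l i
    · rw [Fin.append_right]
      exact h2 l i
  refine Fintype.mem_piFinset.2 fun j => ?_
  refine Fin.addCases (fun i => ?_) (fun i => ?_) j
  · have hval : c.junction k ω (Fin.castAdd n i) = (fun f : F =>
        c.clean (fun l => Fin.append (symbols ω.1 l) (symbols ω.2 l)) k (Fin.castAdd n i) f) -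
        fun f : F => c.clean (symbols ω.1) k i f := by
      funext f
      simp only [junction, Pi.sub_apply, Fin.append_left, received, symbols_append]
      ring
    rw [hval]
    split_ifs with h
    · exact Finset.mem_image.2 ⟨(_, _), Finset.mem_product.2
        ⟨clean_mem_branchSignals hA ha h12 k _, clean_mem_branchSignals hA ha h1 k _⟩, rfl⟩
    · have hi : (i : ℕ) + c.reach k < m := by
        simp only [Fin.val_castAdd] at h
        omega
      simp only [c.clean_append_left _ _ k i hi, sub_self, Finset.mem_singleton]
  · have hval : c.junction k ω (Fin.natAdd m i) = (fun f : F =>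
        c.clean (fun l => Fin.append (symbols ω.1 l) (symbols ω.2 l)) k (Fin.natAdd m i) f) -
        fun f : F => c.clean (symbols ω.2) k i f := by
      funext f
      simp only [junction, Pi.sub_apply, Fin.append_right, received, symbols_append]
      ring
    rw [hval]
    split_ifs with h
    · exact Finset.mem_image.2 ⟨(_, _), Finset.mem_product.2
        ⟨clean_mem_branchSignals hA ha h12 k _, clean_mem_branchSignals hA ha h2 k _⟩, rfl⟩
    · have hi : c.reach k ≤ (i : ℕ) := by
        simp only [Fin.val_natAdd] at h
        omega
      simp only [c.clean_append_right _ _ k i hi, sub_self, Finset.mem_singleton]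

omit hA in
/-- The number of values of the junction is bounded independently of the block lengths. -/
lemma card_junctionValues_le (A : Finset ℂ) (F : Finset ℤ) (m n : ℕ) :
    (c.junctionValues k A F m n).card ≤
      ((c.branchSignals k A F).card * (c.branchSignals k A F).card) ^ (2 * c.reach k) := by
  classical
  have hpos : 0 < (c.branchSignals k A F).card :=
    Finset.card_pos.2 ⟨0, Finset.mem_insert_self _ _⟩
  rw [junctionValues, Fintype.card_piFinset]
  simp only [apply_ite Finset.card, Finset.card_singleton]
  rw [Finset.prod_ite, Finset.prod_const_one, mul_one, Finset.prod_const]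
  refine (Nat.pow_le_pow_left (Finset.card_image_le.trans_eq (Finset.card_product _ _)) _).trans
    (Nat.pow_le_pow_right (Nat.mul_pos hpos hpos) ?_)
  calc (Finset.univ.filter fun j : Fin (m + n) =>
        m ≤ (j : ℕ) + c.reach k ∧ (j : ℕ) < m + c.reach k).card
      ≤ (Finset.Ico (m - c.reach k) (m + c.reach k)).card :=
        Finset.card_le_card_of_injOn (fun j => (j : ℕ))
          (fun j hj => by
            have := (Finset.mem_filter.1 hj).2
            exact Finset.mem_coe.2 (Finset.mem_Ico.2 (by dsimp only; omega)))
          fun i _ j _ hij => Fin.ext hij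
    _ ≤ 2 * c.reach k := by rw [Nat.card_Ico]; omega

end Channel

variable {c : Channel} {a : Fin 3 → Fin 3 → ℚ} {A : Fin 3 → Finset ℂ}
  (ha : ∀ k l, k ≠ l → c.h k l = (a k l : ℝ))
  (hA : ∀ l, ∀ x ∈ A l, ‖x‖ ^ 2 ∈ allowedPowers a l) (N : ℝ) {ρ : Fin 3 → Measure ℂ}
  [∀ l, IsProbabilityMeasure (ρ l)] (hρ : ∀ l, ∀ᵐ x ∂(ρ l), x ∈ A l) (F) (k : Fin 3)

include hρ in
lemma ae_symbols_mem (n : ℕ) :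
    ∀ᵐ ω ∂(Measure.pi fun _ : Fin n => slotLaw N ρ F), ∀ l j, symbols ω l j ∈ A l := by
  refine ae_all_iff.2 fun l => ae_all_iff.2 fun j => ?_
  have h1 : ∀ᵐ s ∂(slotLaw N ρ F), s.1 l ∈ A l :=
    Measure.quasiMeasurePreserving_fst.ae
      ((Measure.quasiMeasurePreserving_eval ρ l).ae (hρ l))
  exact (Measure.quasiMeasurePreserving_eval (fun _ : Fin n => slotLaw N ρ F) j).ae h1

include ha hA hρ in
/-- Up to a constant, the mutual information is a subadditive function of the block length: given
the junction, which takes a bounded number of values, the two parts of a block are independent. -/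
lemma slotInfo_add_le (m n : ℕ) : slotInfo c N ρ F k (m + n) ≤
    slotInfo c N ρ F k m + slotInfo c N ρ F k n + ENNReal.ofReal (Real.log
      (((c.branchSignals k (A k) F).card * (c.branchSignals k (A k) F).card) ^ (2 * c.reach k) :
        ℕ)) := by
  have hJ : ∀ᵐ ω ∂((Measure.pi fun _ : Fin m => slotLaw N ρ F).prod
      (Measure.pi fun _ : Fin n => slotLaw N ρ F)),
      c.junction k ω ∈ c.junctionValues k (A k) F m n := by
    filter_upwards [Measure.quasiMeasurePreserving_fst.ae (ae_symbols_mem F N hρ m),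
      Measure.quasiMeasurePreserving_snd.ae (ae_symbols_mem F N hρ n)] with ω h1 h2
    exact Channel.junction_mem_junctionValues hA ha k h1 h2
  have hsent := (measurable_sent k : Measurable (sent k : (Fin m → Slot F) → _))
  have hrec := (c.measurable_received k : Measurable (c.received k : (Fin m → Slot F) → _))
  have hsent' := (measurable_sent k : Measurable (sent k : (Fin n → Slot F) → _))
  have hrec' := (c.measurable_received k : Measurable (c.received k : (Fin n → Slot F) → _))
  set μ := (Measure.pi fun _ : Fin m => slotLaw N ρ F)
  set ν := (Measure.pi fun _ : Fin n => slotLaw N ρ F)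
  have hrr : Measurable fun ω : (Fin m → Slot F) × (Fin n → Slot F) =>
      (c.received k ω.1, c.received k ω.2) := by fun_prop
  have hss : Measurable fun ω : (Fin m → Slot F) × (Fin n → Slot F) =>
      (sent k ω.1, sent k ω.2) := by fun_prop
  calc slotInfo c N ρ F k (m + n)
      = mutualInfo (μ.prod ν) (fun ω => sent k (Fin.append ω.1 ω.2))
          (fun ω => c.received k (Fin.append ω.1 ω.2)) := by
        rw [slotInfo, ← (measurePreserving_append (slotLaw N ρ F) m n).map_eq,
          mutualInfo_map _ measurable_fin_append (measurable_sent k) (c.measurable_received k)]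
    _ = mutualInfo (μ.prod ν) (fun ω => Fin.append (sent k ω.1) (sent k ω.2))
          (fun ω => Fin.append (c.received k ω.1) (c.received k ω.2) + c.junction k ω) := by
        simp only [sent_append, Channel.junction, add_sub_cancel]
    _ ≤ mutualInfo (μ.prod ν) (fun ω => (sent k ω.1, sent k ω.2))
          (fun ω => ((c.received k ω.1, c.received k ω.2), c.junction k ω)) :=
        mutualInfo_comp_le _ hss (hrr.prodMk (c.measurable_junction k)) measurable_fin_append
          (g := fun q : ((Fin m → F → ℂ) × (Fin n → F → ℂ)) × (Fin (m + n) → F → ℂ) =>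
            Fin.append q.1.1 q.1.2 + q.2)
          ((measurable_fin_append.comp measurable_fst).add measurable_snd)
    _ ≤ mutualInfo (μ.prod ν) (fun ω => (sent k ω.1, sent k ω.2))
          (fun ω => (c.received k ω.1, c.received k ω.2)) +
          ENNReal.ofReal (Real.log (c.junctionValues k (A k) F m n).card) :=
        mutualInfo_prodMk_le_add_log _ hss hrr (c.measurable_junction k) _ hJ
    _ ≤ _ := by
        have hcard : 0 < (c.junctionValues k (A k) F m n).card :=
          Finset.card_pos.2 (hJ.exists.elim fun ω h => ⟨_, h⟩)
        refine add_le_add (mutualInfo_prod_le μ ν hsent hrec hsent' hrec')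
          (ENNReal.ofReal_le_ofReal (Real.log_le_log (by exact_mod_cast hcard) ?_))
        exact_mod_cast c.card_junctionValues_le k (A k) F m n

include hρ in
lemma slotInfo_le (n : ℕ) :
    slotInfo c N ρ F k n ≤ ENNReal.ofReal (n * Real.log (A k).card) := by
  classical
  have h := mutualInfo_le_log_card (Measure.pi fun _ : Fin n => slotLaw N ρ F)
    (measurable_sent k) (c.measurable_received k) (Fintype.piFinset fun _ : Fin n => A k) (by
      filter_upwards [ae_symbols_mem F N hρ n] with ω hω
      exact Fintype.mem_piFinset.2 fun j => hω k j)
  simpa [slotInfo, Fintype.card_piFinset, Real.log_pow] using h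

include ha hA hρ in
/-- The information rate of i.i.d. inputs with finite constellations exists. -/
lemma exists_rate : ∃ R : ℝ≥0,
    Tendsto (fun n : ℕ => slotInfo c N ρ F k n / (n : ℝ≥0∞)) atTop (𝓝 (R : ℝ≥0∞)) ∧
    (R : ℝ) ≤ Real.log (A k).card ∧
    ∀ (B : ℝ) (q : ℕ), (∀ n : ℕ, ENNReal.ofReal ((n - q) * B) ≤ slotInfo c N ρ F k n) → B ≤ R := by
  set I := slotInfo c N ρ F k with hI
  have hle : ∀ n, I n ≤ ENNReal.ofReal (n * Real.log (A k).card) := slotInfo_le F N hρ k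
  have htop : ∀ n, I n ≠ ∞ := fun n => ne_top_of_le_ne_top ENNReal.ofReal_ne_top (hle n)
  set C : ℝ := Real.log
    (((c.branchSignals k (A k) F).card * (c.branchSignals k (A k) F).card) ^ (2 * c.reach k) : ℕ)
    with hC
  have hC0 : 0 ≤ C := Real.log_natCast_nonneg _
  have hlog : 0 ≤ Real.log (A k).card := Real.log_natCast_nonneg _
  have hsub : Subadditive fun n => (I n).toReal + C := fun m n => by
    have h := ENNReal.toReal_mono (ENNReal.add_ne_top.2
      ⟨ENNReal.add_ne_top.2 ⟨htop m, htop n⟩, ENNReal.ofReal_ne_top⟩)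
      (slotInfo_add_le F ha hA N hρ k m n)
    rw [ENNReal.toReal_add (ENNReal.add_ne_top.2 ⟨htop m, htop n⟩) ENNReal.ofReal_ne_top,
      ENNReal.toReal_add (htop m) (htop n), ENNReal.toReal_ofReal hC0] at h
    linarith
  have hbdd : BddBelow (Set.range fun n : ℕ => ((I n).toReal + C) / n) :=
    ⟨0, by rintro _ ⟨n, rfl⟩; positivity⟩
  have hlim := hsub.tendsto_lim hbdd
  have hlim' : Tendsto (fun n : ℕ => (I n).toReal / n) atTop (𝓝 hsub.lim) := by
    have h := hlim.sub (tendsto_const_div_atTop_nhds_zero_nat C)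
    rw [sub_zero] at h
    exact h.congr fun n => by ring
  have hlim0 : 0 ≤ hsub.lim := ge_of_tendsto' hlim' fun n => by positivity
  refine ⟨hsub.lim.toNNReal, ?_, ?_, fun B q hB => ?_⟩
  · have h := ENNReal.tendsto_ofReal hlim'
    refine Tendsto.congr' ?_ h
    filter_upwards [eventually_gt_atTop 0] with n hn
    rw [ENNReal.ofReal_div_of_pos (by exact_mod_cast hn), ENNReal.ofReal_toReal (htop n),
      ENNReal.ofReal_natCast]
  · rw [Real.coe_toNNReal _ hlim0]
    refine le_of_tendsto hlim' ?_
    filter_upwards [eventually_gt_atTop 0] with n hn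
    have hn' : (0 : ℝ) < n := by exact_mod_cast hn
    rw [div_le_iff₀ hn', mul_comm]
    exact ENNReal.toReal_le_of_le_ofReal (by positivity) (hle n)
  · rw [Real.coe_toNNReal _ hlim0]
    have h1 : Tendsto (fun n : ℕ => ((n : ℝ) - q) * B / n) atTop (𝓝 B) := by
      have h := (tendsto_const_nhds (x := B)).sub (tendsto_const_div_atTop_nhds_zero_nat (q * B))
      rw [sub_zero] at h
      refine h.congr' ?_
      filter_upwards [eventually_gt_atTop 0] with n hn
      have hn' : (n : ℝ) ≠ 0 := by exact_mod_cast hn.ne'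
      field_simp
    refine le_of_tendsto_of_tendsto' h1 hlim' fun n => ?_
    gcongr
    exact (ENNReal.ofReal_le_iff_le_toReal (htop n)).1 (hB n)

end Rate

/-! ### A lower bound by minimum distance decoding -/

section Decoding

lemma integral_uniformOn_finset {S : Type*} [MeasurableSpace S] [MeasurableSingletonClass S]
    (s : Finset S) (f : S → ℝ) : ∫ a, f a ∂(uniformOn (s : Set S)) = (∑ a ∈ s, f a) / s.card := by
  have hint : IntegrableOn f (s : Set S) Measure.count := by
    rw [← (s : Set S).biUnion_of_singleton, integrableOn_finite_biUnion s.finite_toSet]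
    exact fun i _ => integrableOn_singleton (hx := by simp)
  rw [uniformOn, ProbabilityTheory.cond, integral_smul_measure, setIntegral_finset _
      hint,
    Measure.count_apply_finset, div_eq_inv_mul]
  simp [Measure.real]

variable {F : Finset ℤ} {n : ℕ} (c : Channel) (k : Fin 3)

/-- The received vectors that are decoded to the symbol `x`: in some branch the output is within
`δ` of the symbol, and all other outputs are smaller than `δ`. -/
def decodingRegion (F : Finset ℤ) (δ : ℝ) (x : ℂ) : Set (F → ℂ) :=
  ⋃ f : F, ⋂ f' : F, {y | ‖y f' - if f' = f then c.spm k x else 0‖ < δ}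

/-- At receiver `k`, the points of `A` are at least `2 δ` apart from each other and from the origin;
the origin counts because it is what the filters without signal put out. -/
structure Separated (A : Finset ℂ) (δ : ℝ) : Prop where
  norm_le : ∀ x ∈ A, 2 * δ ≤ ‖c.spm k x‖
  dist_le : ∀ x ∈ A, ∀ y ∈ A, x ≠ y → 2 * δ ≤ ‖c.spm k x - c.spm k y‖

variable {c k} {A : Finset ℂ} {δ : ℝ}

lemma Separated.eq_of_mem (hA : Separated c k A δ) {x x' : ℂ} (hx : x ∈ A) (hx' : x' ∈ A)
    {y : F → ℂ} (h : y ∈ decodingRegion c k F δ x) (h' : y ∈ decodingRegion c k F δ x') :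
    x = x' := by
  obtain ⟨f, hf⟩ := Set.mem_iUnion.1 h
  obtain ⟨f', hf'⟩ := Set.mem_iUnion.1 h'
  have h1 : ‖y f - c.spm k x‖ < δ := by simpa using Set.mem_iInter.1 hf f
  have h2 := Set.mem_iInter.1 hf' f
  by_contra hne
  by_cases hff : f = f'
  · have h2' : ‖y f - c.spm k x'‖ < δ := by simpa [hff] using h2
    have h3 := hA.dist_le x hx x' hx' hne
    have h4 := norm_sub_le (y f - c.spm k x') (y f - c.spm k x)
    rw [sub_sub_sub_cancel_left] at h4
    linarith
  · have h2' : ‖y f‖ < δ := by simpa [hff] using h2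
    have h3 := hA.norm_le x hx
    have h4 := norm_sub_le (y f) (y f - c.spm k x)
    rw [sub_sub_cancel] at h4
    linarith

variable (c k A δ) in
open Classical in
/-- The logarithm of the decoding metric that is `|A| / 2` if `y` is decoded to `x`, and `1 / 2`
otherwise. As the decoding regions are disjoint, the metric has mean at most `1` when `x` is uniform
on `A` and independent of `y`. -/
def score (x : ℂ) (y : F → ℂ) : ℝ :=
  (if y ∈ decodingRegion c k F δ x then Real.log A.card else 0) - Real.log 2

lemma abs_score_le (x : ℂ) (y : F → ℂ) :
    |score c k A δ x y| ≤ Real.log A.card + Real.log 2 := by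
  have h1 : 0 ≤ Real.log A.card := Real.log_natCast_nonneg _
  have h2 : 0 ≤ Real.log 2 := Real.log_nonneg (by norm_num)
  unfold score
  rw [abs_le]
  split_ifs <;> constructor <;> linarith

lemma integral_exp_score_le (hA : Separated c k A δ) (hne : A.Nonempty) (y : F → ℂ) :
    ∫ x, Real.exp (score c k A δ x y) ∂(uniformOn (A : Set ℂ)) ≤ 1 := by
  classical
  have hcard : (0 : ℝ) < A.card := by exact_mod_cast hne.card_pos
  rw [integral_uniformOn_finset, div_le_one hcard]
  have hexp : ∀ x ∈ A, Real.exp (score c k A δ x y) ≤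
      (if y ∈ decodingRegion c k F δ x then (A.card : ℝ) / 2 else 0) + 1 / 2 := fun x _ => by
    unfold score
    rw [Real.exp_sub, Real.exp_log (by norm_num)]
    split_ifs
    · rw [Real.exp_log hcard]
      linarith
    · simp
  refine (Finset.sum_le_sum hexp).trans ?_
  rw [Finset.sum_add_distrib, ← Finset.sum_filter, Finset.sum_const, Finset.sum_const]
  have h1 : (A.filter fun x => y ∈ decodingRegion c k F δ x).card ≤ 1 :=
    Finset.card_le_one.2 fun x hx x' hx' => by
      rw [Finset.mem_filter] at hx hx'
      exact hA.eq_of_mem hx.1 hx'.1 hx.2 hx'.2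
  have h2 : ((A.filter fun x => y ∈ decodingRegion c k F δ x).card : ℝ) ≤ 1 := by
    exact_mod_cast h1
  rw [nsmul_eq_mul, nsmul_eq_mul]
  nlinarith

/-- The decoder succeeds if all noise samples of the slot are smaller than `δ`. -/
lemma le_score {x : ℂ} {y : F → ℂ} {z : F → ℂ} {v : ℤ} (hv : v ∈ F)
    (hy : ∀ f : F, y f = (if (f : ℤ) = v then c.spm k x else 0) + z f) :
    Real.log A.card * (1 - ∑ f : F, {w : ℂ | δ ≤ ‖w‖}.indicator (fun _ => (1 : ℝ)) (z f)) -
      Real.log 2 ≤ score c k A δ x y := by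
  classical
  have h1 : 0 ≤ Real.log A.card := Real.log_natCast_nonneg _
  have hind : ∀ f : F, 0 ≤ {w : ℂ | δ ≤ ‖w‖}.indicator (fun _ => (1 : ℝ)) (z f) :=
    fun f => Set.indicator_nonneg (fun _ _ => zero_le_one) _
  have hsum := Finset.sum_nonneg fun f (_ : f ∈ Finset.univ) => hind f
  unfold score
  refine sub_le_sub_right ?_ _
  split_ifs with hmem
  · nlinarith
    -- otherwise some noise sample is large, and the left-hand side is not positive
  · obtain ⟨f, hf⟩ : ∃ f : F, δ ≤ ‖z f‖ := by
      by_contra! hsmall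
      refine hmem (Set.mem_iUnion.2 ⟨⟨v, hv⟩, Set.mem_iInter.2 fun f => ?_⟩)
      have heq : (f = ⟨v, hv⟩) ↔ ((f : ℤ) = v) := Subtype.ext_iff
      simp only [Set.mem_ofPred_eq, hy f, heq, add_sub_cancel_left]
      exact hsmall f
    have h2 : 1 ≤ ∑ f : F, {w : ℂ | δ ≤ ‖w‖}.indicator (fun _ => (1 : ℝ)) (z f) := by
      refine le_trans ?_ (Finset.single_le_sum (fun f _ => hind f) (Finset.mem_univ f))
      rw [Set.indicator_of_mem (show z f ∈ {w : ℂ | δ ≤ ‖w‖} from hf)]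
    nlinarith

lemma measurable_score_comp {Ω : Type*} [MeasurableSpace Ω] {X : Ω → ℂ} {Y : Ω → F → ℂ}
    (hX : Measurable X) (hY : Measurable Y) : Measurable fun ω => score c k A δ (X ω) (Y ω) := by
  classical
  unfold score
  refine (Measurable.ite ?_ measurable_const measurable_const).sub measurable_const
  simp only [decodingRegion, Set.mem_iUnion, Set.mem_iInter, Set.mem_ofPred_eq, Set.ofPred_exists,
    Set.ofPred_forall]
  refine MeasurableSet.iUnion fun f => MeasurableSet.iInter fun f' => ?_
  refine measurableSet_lt (Measurable.norm (Measurable.sub (by fun_prop) ?_)) measurable_const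
  unfold Channel.spm
  split_ifs <;> fun_prop

variable {a : Fin 3 → Fin 3 → ℚ} {A : Fin 3 → Finset ℂ} {ρ : Fin 3 → Measure ℂ}
  [∀ l, IsProbabilityMeasure (ρ l)] {N δ : ℝ}

variable (c k A δ) in
/-- The logarithm of the decoding metric of a block: the score of all slots away from the ends. -/
def blockScore (x : Fin n → ℂ) (y : Fin n → F → ℂ) : ℝ :=
  ∑ j : Fin n, if c.reach k ≤ (j : ℕ) ∧ (j : ℕ) + c.reach k < n
    then score c k (A k) δ (x j) (y j) else 0

lemma measurable_blockScore :
    Measurable fun p : (Fin n → ℂ) × (Fin n → F → ℂ) => blockScore c k A δ p.1 p.2 := by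
  unfold blockScore
  refine Finset.measurable_sum _ fun j _ => ?_
  split_ifs
  · exact measurable_score_comp (by fun_prop) (by fun_prop)
  · exact measurable_const

lemma abs_blockScore_le (x : Fin n → ℂ) (y : Fin n → F → ℂ) :
    |blockScore c k A δ x y| ≤ n * (Real.log (A k).card + Real.log 2) := by
  have h1 : 0 ≤ Real.log (A k).card := Real.log_natCast_nonneg _
  have h2 : 0 ≤ Real.log 2 := Real.log_nonneg (by norm_num)
  unfold blockScore
  refine (Finset.abs_sum_le_sum_abs _ _).trans ((Finset.sum_le_card_nsmul _ _
    (Real.log (A k).card + Real.log 2) fun j _ => ?_).trans_eq (by simp [mul_add]))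
  split_ifs
  · exact abs_score_le _ _
  · rw [abs_zero]
    positivity

lemma integral_exp_blockScore_le (hA : Separated c k (A k) δ) (hne : (A k).Nonempty)
    (y : Fin n → F → ℂ) :
    ∫ x, Real.exp (blockScore c k A δ x y)
      ∂(Measure.pi fun _ : Fin n => uniformOn (A k : Set ℂ)) ≤ 1 := by
  have := isProbabilityMeasure_uniformOn (s := (A k : Set ℂ)) (A k).finite_toSet
    (by simpa using hne)
  simp only [blockScore, Real.exp_sum]
  rw [integral_fintype_prod_eq_prod (fun (j : Fin n) (x : ℂ) => Real.exp
    (if c.reach k ≤ (j : ℕ) ∧ (j : ℕ) + c.reach k < n then score c k (A k) δ x (y j) else 0))]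
  refine Finset.prod_le_one (fun j _ => integral_nonneg fun x => (Real.exp_pos _).le) fun j _ => ?_
  split_ifs
  · exact integral_exp_score_le hA hne (y j)
  · simp

lemma le_card_interior (r n : ℕ) : (n : ℝ) - (2 * r : ℕ) ≤
    ((Finset.univ.filter fun j : Fin n => r ≤ (j : ℕ) ∧ (j : ℕ) + r < n).card : ℝ) := by
  have h : n - 2 * r ≤
      (Finset.univ.filter fun j : Fin n => r ≤ (j : ℕ) ∧ (j : ℕ) + r < n).card := by
    calc n - 2 * r = (Finset.univ : Finset (Fin (n - 2 * r))).card := by simp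
      _ ≤ _ := Finset.card_le_card_of_injOn (fun i : Fin (n - 2 * r) => (⟨i + r, by omega⟩ : Fin n))
        (fun i _ => by
          simp only [Finset.coe_filter, Finset.mem_univ, true_and, Set.mem_ofPred_eq]
          omega)
        fun i _ j _ hij => Fin.ext (by simpa using hij)
  have h' : (n : ℝ) ≤ ((Finset.univ.filter fun j : Fin n =>
      r ≤ (j : ℕ) ∧ (j : ℕ) + r < n).card : ℝ) + (2 * r : ℕ) := by
    exact_mod_cast Nat.sub_le_iff_le_add.1 h
  linarith

lemma map_slots_noise (j : Fin n) (f : F) :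
    (Measure.pi fun _ : Fin n => slotLaw N ρ F).map (fun ω => (ω j).2 f) = cgauss N :=
  (((measurePreserving_eval (fun _ : F => cgauss N) f).comp measurePreserving_snd).comp
    (measurePreserving_eval (fun _ : Fin n => slotLaw N ρ F) j)).map_eq

lemma map_slots_sent :
    (Measure.pi fun _ : Fin n => slotLaw N ρ F).map (sent k) = Measure.pi fun _ : Fin n => ρ k :=
  (measurePreserving_pi _ _ fun _ : Fin n =>
    (measurePreserving_eval ρ k).comp
      (measurePreserving_fst (μ := Measure.pi ρ) (ν := Measure.pi fun _ : F => cgauss N))).map_eq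

/-- The variational bound applied to the block metric. The error probability of a slot is at most
the probability that one of the noise samples of the bank is large; this turns the decoding
metric into a lower bound of Fano's type. -/
lemma le_slotInfo (ha : ∀ k l, k ≠ l → c.h k l = (a k l : ℝ))
    (hpow : ∀ l, ∀ x ∈ A l, ‖x‖ ^ 2 ∈ allowedPowers a l) (hρ : ∀ l, ∀ᵐ x ∂(ρ l), x ∈ A l)
    (hρk : ρ k = uniformOn (A k : Set ℂ)) (hne : (A k).Nonempty) (hA : Separated c k (A k) δ)
    (hF : ∀ (x : Fin 3 → Fin n → ℂ), (∀ l j, x l j ∈ A l) → ∀ j, c.Interior n k j →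
      ∀ v : ℤ, c.V x k j = v → v ∈ F)
    (hB : 0 ≤ Real.log (A k).card * (1 - F.card * (cgauss N).real {w | δ ≤ ‖w‖}) - Real.log 2) :
    ENNReal.ofReal ((n - (2 * c.reach k : ℕ)) *
      (Real.log (A k).card * (1 - F.card * (cgauss N).real {w | δ ≤ ‖w‖}) - Real.log 2)) ≤
      slotInfo c N ρ F k n := by
  set B := Real.log (A k).card * (1 - F.card * (cgauss N).real {w | δ ≤ ‖w‖}) - Real.log 2
    with hBdef
  set P := Measure.pi fun _ : Fin n => slotLaw N ρ F with hP
  have hs : Measurable (sent k : (Fin n → Slot F) → _) := measurable_sent k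
  have hr : Measurable (c.received k : (Fin n → Slot F) → _) := c.measurable_received k
  have := Measure.isProbabilityMeasure_map (μ := P) hs.aemeasurable
  have := Measure.isProbabilityMeasure_map (μ := P) hr.aemeasurable
  have := Measure.isProbabilityMeasure_map (μ := P) (hs.prodMk hr).aemeasurable
  have hbound : ∀ p : (Fin n → ℂ) × (Fin n → F → ℂ), |blockScore c k A δ p.1 p.2| ≤
      n * (Real.log (A k).card + Real.log 2) := fun p => abs_blockScore_le _ _
  have hfμ : Integrable (fun p : (Fin n → ℂ) × (Fin n → F → ℂ) => blockScore c k A δ p.1 p.2)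
      (P.map fun ω => (sent k ω, c.received k ω)) :=
    Integrable.of_bound measurable_blockScore.aestronglyMeasurable _ (ae_of_all _ hbound)
  have hfν : Integrable
      (fun p : (Fin n → ℂ) × (Fin n → F → ℂ) => Real.exp (blockScore c k A δ p.1 p.2))
      ((P.map (sent k)).prod (P.map (c.received k))) := by
    refine Integrable.of_bound measurable_blockScore.exp.aestronglyMeasurable
      (Real.exp (n * (Real.log (A k).card + Real.log 2))) (ae_of_all _ fun p => ?_)
    rw [Real.norm_eq_abs, Real.abs_exp]
    exact Real.exp_le_exp.2 ((le_abs_self _).trans (hbound p))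
  have hone : ∫ p, Real.exp (blockScore c k A δ p.1 p.2)
      ∂((P.map (sent k)).prod (P.map (c.received k))) ≤ 1 := by
    rw [integral_prod_symm _ hfν]
    calc ∫ y, ∫ x, Real.exp (blockScore c k A δ x y) ∂(P.map (sent k)) ∂(P.map (c.received k))
        ≤ ∫ _, 1 ∂(P.map (c.received k)) := by
          refine integral_mono_of_nonneg
            (ae_of_all _ fun y => integral_nonneg fun x => (Real.exp_pos _).le)
            (integrable_const _) (ae_of_all _ fun y => ?_)
          dsimp only
          rw [hP, map_slots_sent, hρk]
          exact integral_exp_blockScore_le hA hne y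
      _ = 1 := by simp
  refine le_trans (ENNReal.ofReal_le_ofReal ?_) (integral_sub_log_le_klDiv hfμ hfν hone)
  rw [integral_map (hs.prodMk hr).aemeasurable measurable_blockScore.aestronglyMeasurable]
  have hterm : ∀ j : Fin n, Integrable (fun ω => if c.reach k ≤ (j : ℕ) ∧ (j : ℕ) + c.reach k < n
      then score c k (A k) δ (sent k ω j) (c.received k ω j) else 0) P := fun j => by
    split_ifs
    · exact Integrable.of_bound (measurable_score_comp (by fun_prop)
        ((measurable_pi_apply j).comp hr)).aestronglyMeasurable _
        (ae_of_all _ fun ω => abs_score_le _ _)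
    · exact integrable_zero _ _ _
  simp only [blockScore]
  rw [integral_finsetSum _ fun j _ => hterm j]
  have hslot : ∀ j : Fin n, (if c.reach k ≤ (j : ℕ) ∧ (j : ℕ) + c.reach k < n then B else 0) ≤
      ∫ ω, (if c.reach k ≤ (j : ℕ) ∧ (j : ℕ) + c.reach k < n
        then score c k (A k) δ (sent k ω j) (c.received k ω j) else 0) ∂P := by
    intro j
    have htj := hterm j
    split_ifs at htj ⊢ with hj
    · have hmeasE : MeasurableSet {w : ℂ | δ ≤ ‖w‖} :=
        measurableSet_le measurable_const measurable_norm
      have hmz : ∀ f : F, Measurable fun ω : Fin n → Slot F => (ω j).2 f := fun f => by fun_prop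
      have hind : ∀ f : F, Integrable (fun ω : Fin n → Slot F =>
          {w : ℂ | δ ≤ ‖w‖}.indicator (fun _ => (1 : ℝ)) ((ω j).2 f)) P := fun f => by
        refine Integrable.of_bound
          ((measurable_const.indicator hmeasE).comp (hmz f)).aestronglyMeasurable 1
          (ae_of_all _ fun ω => ?_)
        rw [Real.norm_eq_abs, abs_of_nonneg (Set.indicator_nonneg (fun _ _ => zero_le_one) _)]
        exact Set.indicator_le_self' (fun _ _ => zero_le_one) _
      have hval : ∀ f : F, ∫ ω, {w : ℂ | δ ≤ ‖w‖}.indicator (fun _ => (1 : ℝ)) ((ω j).2 f) ∂P =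
          (cgauss N).real {w | δ ≤ ‖w‖} := fun f => by
        rw [← integral_map (φ := fun ω : Fin n → Slot F => (ω j).2 f) (hmz f).aemeasurable
          (measurable_const.indicator hmeasE).aestronglyMeasurable, hP, map_slots_noise]
        exact integral_indicator_one hmeasE
      have hsumint := integrable_finsetSum Finset.univ fun f (_ : f ∈ Finset.univ) => hind f
      have hdiff : Integrable (fun ω : Fin n → Slot F => 1 - ∑ f : F,
          {w : ℂ | δ ≤ ‖w‖}.indicator (fun _ => (1 : ℝ)) ((ω j).2 f)) P :=
        (integrable_const _).sub hsumint
      have hlow : Integrable (fun ω : Fin n → Slot F => Real.log (A k).card * (1 - ∑ f : F,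
          {w : ℂ | δ ≤ ‖w‖}.indicator (fun _ => (1 : ℝ)) ((ω j).2 f)) - Real.log 2) P :=
        (hdiff.const_mul _).sub (integrable_const _)
      calc B = ∫ ω, (Real.log (A k).card * (1 - ∑ f : F,
            {w : ℂ | δ ≤ ‖w‖}.indicator (fun _ => (1 : ℝ)) ((ω j).2 f)) - Real.log 2) ∂P := by
            rw [integral_sub (hdiff.const_mul _) (integrable_const _),
              integral_const_mul, integral_sub (integrable_const _) hsumint,
              integral_finsetSum _ fun f _ => hind f]
            simp [hval, hBdef]
        _ ≤ _ := by
            refine integral_mono_ae hlow htj ?_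
            filter_upwards [ae_symbols_mem F N hρ n] with ω hω
            have hω' : ∀ l j, ‖symbols ω l j‖ ^ 2 ∈ allowedPowers a l :=
              fun l j => hpow l _ (hω l j)
            obtain ⟨v, hv⟩ := Channel.exists_int_V_eq ha hω' k j
            refine le_score (v := v) (z := (ω j).2)
              (hF _ hω j (c.interior_of_reach hj.1 hj.2) v hv) fun f => ?_
            rw [Channel.received, Channel.clean_eq_ite ha hω' k j hv]
            rfl
    · simp
  refine le_trans ?_ (Finset.sum_le_sum fun j _ => hslot j)
  rw [← Finset.sum_filter, Finset.sum_const, nsmul_eq_mul]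
  exact mul_le_mul_of_nonneg_right (le_card_interior _ _) hB

end Decoding

/-! ### Ring constellations and the tail of the noise -/

section Rings

/-- The point with angle `p.2 / (S + 1)` on the ring of radius `d (S + p.1)`. -/
def ringPoint (d : ℝ) (S : ℕ) (p : ℕ × ℕ) : ℂ :=
  (d * (S + p.1) : ℝ) * Complex.exp (Complex.I * ((p.2 : ℝ) / (S + 1) : ℝ))

/-- The constellation of `(S + 1)²` points on the `S + 1` rings of radii `d S, …, 2 d S`. The
angles stay below one radian, so no two of them are close modulo `2π`. -/
def ringSet (d : ℝ) (S : ℕ) : Finset ℂ :=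
  (Finset.range (S + 1) ×ˢ Finset.range (S + 1)).image (ringPoint d S)

/-- The powers of the rings of `ringSet d S`. -/
def ringPowers (d : ℝ) (S : ℕ) : Finset ℝ :=
  (Finset.range (S + 1)).image fun i : ℕ => (d * (S + i)) ^ 2

variable {d : ℝ} {S : ℕ}

lemma norm_ringPoint (hd : 0 ≤ d) (p : ℕ × ℕ) : ‖ringPoint d S p‖ = d * (S + p.1) := by
  rw [ringPoint, norm_mul, Complex.norm_exp_I_mul_ofReal, mul_one, Complex.norm_real,
    Real.norm_of_nonneg (by positivity)]

lemma ringSet_nonempty : (ringSet d S).Nonempty := by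
  simp [ringSet, Finset.image_nonempty, Finset.nonempty_product]

lemma sq_norm_mem_ringPowers (hd : 0 ≤ d) {x : ℂ} (hx : x ∈ ringSet d S) :
    ‖x‖ ^ 2 ∈ ringPowers d S := by
  obtain ⟨p, hp, rfl⟩ := Finset.mem_image.1 hx
  rw [norm_ringPoint hd]
  exact Finset.mem_image_of_mem _ (Finset.mem_product.1 hp).1

lemma ringPowers_le (hd : 0 ≤ d) {w : ℝ} (hw : w ∈ ringPowers d S) : w ≤ (2 * d * S) ^ 2 := by
  obtain ⟨i, hi, rfl⟩ := Finset.mem_image.1 hw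
  have hi' : (i : ℝ) ≤ S := by exact_mod_cast Finset.mem_range_succ_iff.1 hi
  have h : d * (S + i) ≤ 2 * d * S := by nlinarith
  exact pow_le_pow_left₀ (by positivity) h 2

lemma ringPowers_pos (hd : 0 < d) (hS : 0 < S) {w : ℝ} (hw : w ∈ ringPowers d S) : 0 < w := by
  obtain ⟨i, -, rfl⟩ := Finset.mem_image.1 hw
  have : (0 : ℝ) < S := by exact_mod_cast hS
  positivity

lemma card_ringPowers_le : (ringPowers d S).card ≤ S + 1 :=
  Finset.card_image_le.trans_eq (Finset.card_range _)

lemma norm_exp_sub_exp_ge {s t : ℝ} (h : |s - t| ≤ 1) :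
    |s - t| / 2 ≤ ‖Complex.exp (Complex.I * s) - Complex.exp (Complex.I * t)‖ := by
  have h1 : Complex.exp (Complex.I * s) - Complex.exp (Complex.I * t) =
      Complex.exp (Complex.I * t) * (Complex.exp (Complex.I * (s - t : ℝ)) - 1) := by
    rw [mul_sub, ← Complex.exp_add, mul_one, ← mul_add]
    push_cast
    ring_nf
  rw [h1, norm_mul, Complex.norm_exp_I_mul_ofReal, one_mul, Complex.norm_exp_I_mul_ofReal_sub_one,
    Real.norm_eq_abs, abs_mul, abs_of_pos (by norm_num : (0 : ℝ) < 2)]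
  have hpi := Real.pi_gt_three
  have habs : |Real.sin ((s - t) / 2)| = Real.sin (|s - t| / 2) := by
    rw [Real.abs_sin_eq_sin_abs_of_abs_le_pi (x := (s - t) / 2)
      (by rw [abs_div, abs_of_pos (by norm_num : (0 : ℝ) < 2)]; linarith), abs_div,
      abs_of_pos (by norm_num : (0 : ℝ) < 2)]
  have h2 := Real.mul_le_sin (x := |s - t| / 2) (by positivity) (by linarith)
  have h3 : 2 / Real.pi ≥ 1 / 2 := by
    rw [ge_iff_le, div_le_div_iff₀ (by norm_num) Real.pi_pos]
    linarith [Real.pi_le_four]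
  rw [habs]
  nlinarith [abs_nonneg (s - t)]

lemma norm_spm (c : Channel) (k : Fin 3) (x : ℂ) : ‖c.spm k x‖ = ‖x‖ := by
  rw [Channel.spm, norm_mul, Complex.norm_exp_I_mul_ofReal, mul_one]

/-- Self-phase modulation turns each ring rigidly, so it does not bring any two points of the
constellation together: different rings stay `d` apart, and on one ring the arc between
neighbouring points has length at least `d S / (S + 1)`. -/
lemma norm_spm_ringPoint_sub_ge (c : Channel) (k : Fin 3) (hd : 0 < d) (hS : 0 < S)
    {p q : ℕ × ℕ} (hp : p.2 ≤ S) (hq : q.2 ≤ S) (hpq : p ≠ q) :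
    d / 4 ≤ ‖c.spm k (ringPoint d S p) - c.spm k (ringPoint d S q)‖ := by
  by_cases h1 : p.1 = q.1
  · have h2 : p.2 ≠ q.2 := fun h => hpq (Prod.ext h1 h)
    have hS' : (1 : ℝ) ≤ S := by exact_mod_cast hS
    set s : ℝ := (p.2 : ℝ) / (S + 1) with hs
    set t : ℝ := (q.2 : ℝ) / (S + 1) with ht
    have hst : |s - t| = |(p.2 : ℝ) - q.2| / (S + 1) := by
      rw [hs, ht, ← sub_div, abs_div, abs_of_pos (by positivity : (0 : ℝ) < S + 1)]
    have hone : (1 : ℝ) ≤ |(p.2 : ℝ) - q.2| := by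
      have : (1 : ℤ) ≤ |(p.2 : ℤ) - q.2| := Int.one_le_abs (sub_ne_zero.2 (by exact_mod_cast h2))
      exact_mod_cast this
    have hle : |(p.2 : ℝ) - q.2| ≤ S := by
      have hp' : (p.2 : ℝ) ≤ S := by exact_mod_cast hp
      have hq' : (q.2 : ℝ) ≤ S := by exact_mod_cast hq
      rw [abs_le]
      constructor <;> linarith [(Nat.cast_nonneg p.2 : (0 : ℝ) ≤ p.2),
        (Nat.cast_nonneg q.2 : (0 : ℝ) ≤ q.2)]
    have h3 := norm_exp_sub_exp_ge (s := s) (t := t) (by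
      rw [hst, div_le_one (by positivity)]
      linarith)
    have h4 : 1 / (S + 1) ≤ |s - t| := by
      rw [hst]
      gcongr
    have h5 : c.spm k (ringPoint d S p) - c.spm k (ringPoint d S q) =
        (d * (S + p.1) : ℝ) * Complex.exp (Complex.I * (c.h k k * (d * (S + p.1)) ^ 2 : ℝ)) *
          (Complex.exp (Complex.I * s) - Complex.exp (Complex.I * t)) := by
      rw [Channel.spm, Channel.spm, norm_ringPoint hd.le, norm_ringPoint hd.le, ringPoint,
        ringPoint, h1]
      ring
    rw [h5, norm_mul, norm_mul, Complex.norm_exp_I_mul_ofReal, mul_one, Complex.norm_real,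
      Real.norm_of_nonneg (by positivity)]
    have h6 : d * S * (1 / (S + 1) / 2) ≤ d * (S + p.1) *
        ‖Complex.exp (Complex.I * s) - Complex.exp (Complex.I * t)‖ := by
      gcongr
      · linarith [(Nat.cast_nonneg p.1 : (0 : ℝ) ≤ p.1)]
      · linarith
    refine le_trans ?_ h6
    rw [div_div, mul_one_div, div_le_div_iff₀ (by norm_num) (by positivity)]
    nlinarith
  · have hone : (1 : ℝ) ≤ |(p.1 : ℝ) - q.1| := by
      have : (1 : ℤ) ≤ |(p.1 : ℤ) - q.1| := Int.one_le_abs (sub_ne_zero.2 (by exact_mod_cast h1))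
      exact_mod_cast this
    refine le_trans ?_ (abs_norm_sub_norm_le _ _)
    rw [norm_spm, norm_spm, norm_ringPoint hd.le, norm_ringPoint hd.le, ← mul_sub,
      add_sub_add_left_eq_sub, abs_mul, abs_of_pos hd]
    nlinarith

lemma separated_ringSet (c : Channel) (k : Fin 3) (hd : 0 < d) (hS : 0 < S) :
    Separated c k (ringSet d S) (d / 8) := by
  constructor
  · intro x hx
    obtain ⟨p, -, rfl⟩ := Finset.mem_image.1 hx
    rw [norm_spm, norm_ringPoint hd.le]
    have hS' : (1 : ℝ) ≤ S := by exact_mod_cast hS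
    nlinarith [(Nat.cast_nonneg p.1 : (0 : ℝ) ≤ p.1),
      mul_nonneg hd.le (Nat.cast_nonneg p.1 : (0 : ℝ) ≤ p.1)]
  · intro x hx y hy hxy
    obtain ⟨p, hp, rfl⟩ := Finset.mem_image.1 hx
    obtain ⟨q, hq, rfl⟩ := Finset.mem_image.1 hy
    rw [Finset.mem_product, Finset.mem_range_succ_iff, Finset.mem_range_succ_iff] at hp hq
    have := norm_spm_ringPoint_sub_ge c k hd hS hp.2 hq.2 fun h => hxy (by rw [h])
    linarith

lemma card_ringSet_le : (ringSet d S).card ≤ (S + 1) ^ 2 :=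
  Finset.card_image_le.trans_eq (by simp [sq])

lemma card_ringSet (hd : 0 < d) (hS : 0 < S) : (ringSet d S).card = (S + 1) ^ 2 := by
  rw [ringSet, Finset.card_image_of_injOn, Finset.card_product, Finset.card_range, sq]
  intro p hp q hq h
  rw [Finset.mem_coe, Finset.mem_product, Finset.mem_range_succ_iff, Finset.mem_range_succ_iff]
    at hp hq
  by_contra hpq
  -- the separation of the points holds for any channel, in particular for the trivial one
  have := norm_spm_ringPoint_sub_ge ⟨0, 1, fun _ _ _ => one_pos⟩ 0 hd hS hp.2 hq.2 hpq
  rw [h, sub_self, norm_zero] at this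
  linarith

lemma card_focusBank_le (c : Channel) (k : Fin 3) (W : Finset ℝ) :
    (c.focusBank (fun _ => W) k).card ≤ W.card ^ 6 := by
  calc (c.focusBank (fun _ => W) k).card ≤ (c.shifts (fun _ => W) k).card :=
        Finset.card_le_card_of_injOn (fun f : ℤ => (f : ℝ)) (fun f hf => Finset.mem_preimage.1 hf)
          Int.cast_injective.injOn
    _ ≤ (Fintype.piFinset fun _ : Fin 3 => W ×ˢ W).card := Finset.card_image_le
    _ = W.card ^ 6 := by
        rw [Fintype.card_piFinset, Finset.prod_const, Finset.card_product, Finset.card_univ,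
          Fintype.card_fin]
        ring

end Rings

section Noise

/-- Chernoff's bound with exponent `1`; the rate of decay is not optimal, but any exponential is
enough if the spacing of the rings grows faster than the logarithm of the number of outputs. -/
lemma cgauss_norm_ge_le {N : ℝ} (hN : 0 ≤ N) (δ : ℝ) :
    (cgauss N).real {w | δ ≤ ‖w‖} ≤ 4 * Real.exp (N / 4 - δ / 2) := by
  set G := gaussianReal 0 (N / 2).toNNReal with hG
  have hmap : Measurable fun w : ℝ × ℝ => (w.1 : ℂ) + w.2 * Complex.I := by fun_prop
  have h1 : (cgauss N).map Complex.re = G := by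
    rw [cgauss, Measure.map_map Complex.measurable_re hmap]
    convert measurePreserving_fst (μ := G) (ν := G) |>.map_eq using 2
    ext w
    simp
  have h2 : (cgauss N).map Complex.im = G := by
    rw [cgauss, Measure.map_map Complex.measurable_im hmap]
    convert measurePreserving_snd (μ := G) (ν := G) |>.map_eq using 2
    ext w
    simp
  have hneg : ∀ X : ℂ → ℝ, Measurable X → (cgauss N).map X = G →
      (cgauss N).map (fun w => -X w) = G := fun X hX h => by
    have := gaussianReal_map_neg (μ := 0) (v := (N / 2).toNNReal)
    rw [← hG, ← h, Measure.map_map measurable_neg hX, neg_zero] at this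
    exact this
  have htail : ∀ X : ℂ → ℝ, Measurable X → (cgauss N).map X = G →
      (cgauss N).real {w | δ / 2 ≤ X w} ≤ Real.exp (N / 4 - δ / 2) := fun X hX h => by
    have hint : Integrable (fun w => Real.exp (1 * X w)) (cgauss N) := by
      have := integrable_exp_mul_gaussianReal (μ := 0) (v := (N / 2).toNNReal) 1
      rw [← hG, ← h] at this
      exact this.comp_measurable hX
    refine (measure_ge_le_exp_mul_mgf (δ / 2) zero_le_one hint).trans_eq ?_
    rw [mgf_gaussianReal h, ← Real.exp_add, Real.coe_toNNReal _ (by positivity)]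
    ring_nf
  have hsub : {w : ℂ | δ ≤ ‖w‖} ⊆ ({w | δ / 2 ≤ w.re} ∪ {w | δ / 2 ≤ -w.re}) ∪
      ({w | δ / 2 ≤ w.im} ∪ {w | δ / 2 ≤ -w.im}) := fun w hw => by
    by_contra hcon
    simp only [Set.mem_union, Set.mem_ofPred_eq, not_or, not_le] at hcon hw
    have h3 : |w.re| < δ / 2 := abs_lt.2 ⟨by linarith [hcon.1.2], hcon.1.1⟩
    have h4 : |w.im| < δ / 2 := abs_lt.2 ⟨by linarith [hcon.2.2], hcon.2.1⟩
    linarith [Complex.norm_le_abs_re_add_abs_im w]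
  refine (measureReal_mono hsub).trans ((measureReal_union_le _ _).trans ?_)
  have h3 := measureReal_union_le (μ := cgauss N) {w | δ / 2 ≤ w.re} {w | δ / 2 ≤ -w.re}
  have h4 := measureReal_union_le (μ := cgauss N) {w | δ / 2 ≤ w.im} {w | δ / 2 ≤ -w.im}
  have h5 := htail _ Complex.measurable_re h1
  have h6 := htail _ Complex.measurable_re.neg (hneg _ Complex.measurable_re h1)
  have h7 := htail _ Complex.measurable_im h2
  have h8 := htail _ Complex.measurable_im.neg (hneg _ Complex.measurable_im h2)
  simp only [Pi.neg_apply] at h6 h8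
  linarith

end Noise

/-! ### Growth of the rates with the power -/

section Parameters

variable (a : Fin 3 → Fin 3 → ℚ)

/-- A spacing of the rings that grows like `(log P)²`, and whose square is a common multiple of all
`2π p̂_l`. -/
def spacing (P : ℝ) : ℝ := √(2 * Real.pi * ∏ l, pHat a l) * ⌈Real.log P⌉₊ ^ 2

/-- The largest `S` for which the outer ring, of radius `2 d S`, has power at most `P`. If the
spacing `d` is `0`, then this is `0`, and the constellation consists of the origin. -/
def levels (P : ℝ) : ℕ := ⌊√P / (2 * spacing a P)⌋₊

lemma spacing_nonneg (P : ℝ) : 0 ≤ spacing a P := by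
  unfold spacing
  positivity

lemma ringPowers_subset (P : ℝ) (S : ℕ) (l : Fin 3) :
    (ringPowers (spacing a P) S : Set ℝ) ⊆ allowedPowers a l := by
  intro w hw
  obtain ⟨i, -, rfl⟩ := Finset.mem_image.1 (Finset.mem_coe.1 hw)
  refine ⟨(∏ l' ∈ Finset.univ.erase l, pHat a l') * ⌈Real.log P⌉₊ ^ 4 * (S + i) ^ 2, ?_⟩
  rw [spacing, mul_pow, mul_pow, Real.sq_sqrt (by positivity),
    ← Finset.mul_prod_erase Finset.univ _ (Finset.mem_univ l)]
  push_cast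
  ring

lemma ringPowers_le_power {P : ℝ} (hP : 0 ≤ P) {w : ℝ}
    (hw : w ∈ ringPowers (spacing a P) (levels a P)) : w ≤ P := by
  have hd := spacing_nonneg a P
  refine (ringPowers_le hd hw).trans ?_
  have h : 2 * spacing a P * levels a P ≤ √P := by
    have h1 : (levels a P : ℝ) ≤ √P / (2 * spacing a P) := Nat.floor_le (by positivity)
    rcases hd.eq_or_lt with h0 | h0
    · rw [← h0, mul_zero, zero_mul]
      positivity
    · rwa [le_div_iff₀' (by positivity)] at h1
  calc (2 * spacing a P * levels a P) ^ 2 ≤ √P ^ 2 := pow_le_pow_left₀ (by positivity) h 2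
    _ = P := Real.sq_sqrt hP

lemma two_le_sqrt : 2 ≤ √(2 * Real.pi * ∏ l, pHat a l) := by
  refine Real.le_sqrt_of_sq_le ?_
  have h1 : (1 : ℝ) ≤ (∏ l, pHat a l : ℕ) := by
    exact_mod_cast Finset.prod_pos fun l _ => pHat_pos a l
  nlinarith [Real.pi_gt_three]

lemma sq_log_le_spacing {P : ℝ} (hP : 1 ≤ P) : 2 * Real.log P ^ 2 ≤ spacing a P := by
  unfold spacing
  have h := Real.log_nonneg hP
  gcongr
  · exact two_le_sqrt a
  · exact Nat.le_ceil _

/-- The lower bound for `2 log (S + 1)`, as a function of `log P`. -/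
def levelBound (L : ℝ) : ℝ :=
  L - 2 * Real.log (2 * √(2 * Real.pi * ∏ l, pHat a l)) - 4 * Real.log (L + 1)

lemma levelBound_le {P : ℝ} (hP : 1 < P) :
    levelBound a (Real.log P) ≤ 2 * Real.log (levels a P + 1) := by
  have hL := Real.log_pos hP
  have hc : (0 : ℝ) < √(2 * Real.pi * ∏ l, pHat a l) := two_pos.trans_le (two_le_sqrt a)
  have hP0 : 0 < √P := Real.sqrt_pos.2 (by linarith)
  have hd : spacing a P ≤ √(2 * Real.pi * ∏ l, pHat a l) * (Real.log P + 1) ^ 2 := by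
    unfold spacing
    gcongr
    exact (Nat.ceil_lt_add_one hL.le).le
  have hd0 : 0 < spacing a P := lt_of_lt_of_le (by positivity) (sq_log_le_spacing a hP.le)
  have h1 : √P / (2 * (√(2 * Real.pi * ∏ l, pHat a l) * (Real.log P + 1) ^ 2)) ≤
      levels a P + 1 := by
    refine le_trans ?_ (Nat.lt_floor_add_one (√P / (2 * spacing a P))).le
    gcongr
  have h2 := Real.log_le_log (by positivity) h1
  rw [Real.log_div hP0.ne' (by positivity), ← mul_assoc, Real.log_mul (by positivity)
    (by positivity), Real.log_pow, Real.log_sqrt (by linarith)] at h2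
  unfold levelBound
  rw [Nat.cast_ofNat] at h2
  linarith

lemma levels_add_one_sq_le {P : ℝ} (hP : 4 ≤ P) (hL : 1 ≤ Real.log P) :
    ((levels a P : ℝ) + 1) ^ 2 ≤ P := by
  have h2 : 2 ≤ √P := Real.le_sqrt_of_sq_le (by linarith)
  have hd : 2 ≤ spacing a P := by
    have := sq_log_le_spacing a (P := P) (by linarith)
    nlinarith
  have h1 : (levels a P : ℝ) ≤ √P / 4 := by
    refine (Nat.floor_le (by positivity)).trans ?_
    gcongr
    linarith
  calc ((levels a P : ℝ) + 1) ^ 2 ≤ √P ^ 2 := pow_le_pow_left₀ (by positivity) (by linarith) 2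
    _ = P := Real.sq_sqrt (by linarith)

/-- The lower bound for the rates, as a function of `L = log P`. -/
def rateBound (N L : ℝ) : ℝ :=
  levelBound a L * (1 - 4 * Real.exp (N / 4 + L * (3 - L / 8))) - Real.log 2

lemma tendsto_levelBound_div : Tendsto (fun L => levelBound a L / L) atTop (𝓝 1) := by
  have h1 : Tendsto (fun L : ℝ => Real.log (L + 1) / L) atTop (𝓝 0) := by
    have := (Real.tendsto_pow_log_div_mul_add_atTop 1 (-1) 1 one_ne_zero).comp
      (tendsto_atTop_add_const_right atTop 1 tendsto_id)
    refine this.congr fun L => ?_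
    simp
  have h2 : Tendsto (fun L : ℝ => 2 * Real.log (2 * √(2 * Real.pi * ∏ l, pHat a l)) / L)
      atTop (𝓝 0) := tendsto_const_nhds.div_atTop tendsto_id
  have h3 := (tendsto_const_nhds (x := (1 : ℝ))).sub h2 |>.sub (h1.const_mul 4)
  rw [sub_zero, mul_zero, sub_zero] at h3
  refine h3.congr' ?_
  filter_upwards [eventually_gt_atTop 0] with L hL
  rw [levelBound, sub_div, sub_div, div_self hL.ne', mul_div_assoc 4]

lemma tendsto_rateBound_div (N : ℝ) : Tendsto (fun L => rateBound a N L / L) atTop (𝓝 1) := by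
  have h1 : Tendsto (fun L : ℝ => N / 4 + L * (3 - L / 8)) atTop atBot := by
    refine tendsto_atBot_add_const_left _ _ (tendsto_id.atTop_mul_atBot₀ ?_)
    exact tendsto_atBot_add_const_left _ _
      (tendsto_neg_atTop_atBot.comp (tendsto_id.atTop_div_const (by norm_num)))
  have h2 := (tendsto_const_nhds (x := (1 : ℝ))).sub ((Real.tendsto_exp_atBot.comp h1).const_mul 4)
  have h3 : Tendsto (fun L : ℝ => Real.log 2 / L) atTop (𝓝 0) :=
    tendsto_const_nhds.div_atTop tendsto_id
  have h4 := ((tendsto_levelBound_div a).mul h2).sub h3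
  rw [mul_zero, sub_zero, one_mul, sub_zero] at h4
  refine h4.congr fun L => ?_
  rw [rateBound, Function.comp_apply]
  ring

lemma eventually_levels_pos :
    ∀ᶠ P in atTop, 4 ≤ P ∧ 1 ≤ Real.log P ∧ 0 < spacing a P ∧ 0 < levels a P := by
  have h := Real.tendsto_log_atTop.eventually
    (((tendsto_levelBound_div a).eventually_const_lt zero_lt_one).and (eventually_gt_atTop 0))
  filter_upwards [h, Real.tendsto_log_atTop.eventually_ge_atTop 1, eventually_ge_atTop 4]
    with P hP h1 h4
  refine ⟨h4, h1, lt_of_lt_of_le (by positivity) (sq_log_le_spacing a (by linarith)), ?_⟩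
  have h2 := levelBound_le a (P := P) (by linarith)
  rw [div_pos_iff_of_pos_right hP.2] at hP
  refine Nat.pos_of_ne_zero fun h0 => ?_
  rw [h0, Nat.cast_zero, zero_add, Real.log_one] at h2
  linarith [hP.1]

end Parameters

section Rates

variable {c : Channel} {a : Fin 3 → Fin 3 → ℚ} (ha : ∀ k l, k ≠ l → c.h k l = (a k l : ℝ))

include ha in
/-- The information rates of uniform ring inputs: the limits exist, and are between the bound that
minimum distance decoding gives and the entropy of the symbols. -/
lemma exists_rate_ringSet {P N : ℝ} (hN : 0 < N) (k : Fin 3) (S : ℕ) : ∃ R : ℝ≥0,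
    Tendsto (fun n : ℕ => c.blockInfo N (fun _ => Measure.pi fun _ : Fin n =>
        uniformOn (ringSet (spacing a P) S : Set ℂ))
      (c.focusBank (fun _ => ringPowers (spacing a P) S) k) k / (n : ℝ≥0∞)) atTop (𝓝 R) ∧
    (R : ℝ) ≤ 2 * Real.log (S + 1) ∧
    (0 < spacing a P → 0 < S → 2 * Real.log (S + 1) *
      (1 - ((S : ℝ) + 1) ^ 6 * (4 * Real.exp (N / 4 - spacing a P / 16))) - Real.log 2 ≤ R) := by
  set d := spacing a P with hd
  have hd0 : 0 ≤ d := spacing_nonneg a P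
  set F := c.focusBank (fun _ => ringPowers d S) k with hF
  have : IsProbabilityMeasure (uniformOn (ringSet d S : Set ℂ)) :=
    isProbabilityMeasure_uniformOn (ringSet d S).finite_toSet (by simpa using ringSet_nonempty)
  have hρ : ∀ _ : Fin 3, ∀ᵐ x ∂(uniformOn (ringSet d S : Set ℂ)), x ∈ ringSet d S := fun _ =>
    ae_cond_mem (Finset.measurableSet _)
  have hA : ∀ l : Fin 3, ∀ x ∈ ringSet d S, ‖x‖ ^ 2 ∈ allowedPowers a l := fun l x hx =>
    ringPowers_subset a P S l (sq_norm_mem_ringPowers hd0 hx)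
  obtain ⟨R, hR, hle, hge⟩ := exists_rate (A := fun _ => ringSet d S) F ha hA N hρ k
  refine ⟨R, ?_, ?_, fun hd' hS => ?_⟩
  · refine hR.congr fun n => ?_
    rw [slotInfo, ← Channel.blockInfo_eq]
  · refine hle.trans ?_
    have h1 : ((ringSet d S).card : ℝ) ≤ ((S : ℝ) + 1) ^ 2 := by exact_mod_cast card_ringSet_le
    have h2 : (0 : ℝ) < (ringSet d S).card := by exact_mod_cast ringSet_nonempty.card_pos
    refine (Real.log_le_log h2 h1).trans_eq ?_
    rw [Real.log_pow]
    norm_num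
  · have hcard : Real.log (ringSet d S).card = 2 * Real.log (S + 1) := by
      rw [card_ringSet hd' hS]
      push_cast
      rw [Real.log_pow]
      norm_num
    have hlog : 0 ≤ 2 * Real.log ((S : ℝ) + 1) := by
      have : 0 ≤ Real.log ((S : ℝ) + 1) := Real.log_nonneg (by simp)
      positivity
    have hFle : (F.card : ℝ) ≤ ((S : ℝ) + 1) ^ 6 := by
      exact_mod_cast (card_focusBank_le c k _).trans (Nat.pow_le_pow_left card_ringPowers_le 6)
    have htail := cgauss_norm_ge_le hN.le (d / 8)
    have hle' : 2 * Real.log (S + 1) *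
        (1 - ((S : ℝ) + 1) ^ 6 * (4 * Real.exp (N / 4 - d / 16))) - Real.log 2 ≤
        Real.log (ringSet d S).card *
          (1 - F.card * (cgauss N).real {w | d / 8 ≤ ‖w‖}) - Real.log 2 := by
      rw [hcard]
      have : d / 8 / 2 = d / 16 := by ring
      rw [this] at htail
      gcongr
    refine hle'.trans ?_
    by_cases hB : 0 ≤ Real.log (ringSet d S).card *
        (1 - F.card * (cgauss N).real {w | d / 8 ≤ ‖w‖}) - Real.log 2
    · refine hge _ (2 * c.reach k) fun n => le_slotInfo (A := fun _ => ringSet d S) ha hA hρ rfl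
        ringSet_nonempty (separated_ringSet c k hd' hS) (fun x hx j hj v hv => ?_) hB
      exact Channel.mem_focusBank (fun l j => sq_norm_mem_ringPowers hd0 (hx l j)) hv hj
    · exact (not_le.1 hB).le.trans R.2

lemma powerConstraint_pi {P : ℝ} {ρ : Measure ℂ} [IsProbabilityMeasure ρ]
    (h : ∀ᵐ x ∂ρ, ‖x‖ ^ 2 ≤ P) (n : ℕ) : PowerConstraint P (Measure.pi fun _ : Fin n => ρ) := by
  unfold PowerConstraint
  have h1 : ∫⁻ x, ‖x‖ₑ ^ 2 ∂ρ ≤ ENNReal.ofReal P := by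
    calc ∫⁻ x, ‖x‖ₑ ^ 2 ∂ρ ≤ ∫⁻ _, ENNReal.ofReal P ∂ρ := by
          refine lintegral_mono_ae ?_
          filter_upwards [h] with x hx
          rw [← ofReal_norm, ← ENNReal.ofReal_pow (norm_nonneg x)]
          exact ENNReal.ofReal_le_ofReal hx
      _ = ENNReal.ofReal P := by simp
  have h2 : ∀ j : Fin n, ∫⁻ x, ‖x j‖ₑ ^ 2 ∂(Measure.pi fun _ : Fin n => ρ) =
      ∫⁻ x, ‖x‖ₑ ^ 2 ∂ρ := fun j =>
    (measurePreserving_eval (fun _ : Fin n => ρ) j).lintegral_comp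
      (f := fun x => ‖x‖ₑ ^ 2) (by fun_prop)
  simp only [h2, Finset.sum_const, Finset.card_univ, Fintype.card_fin, nsmul_eq_mul]
  gcongr

/-- A rate between `rateBound` and `log P` has pre-log `1`. -/
lemma tendsto_div_log_of_bounds (a : Fin 3 → Fin 3 → ℚ) {N : ℝ} (hN : 0 < N) {R : ℝ → ℝ}
    (hlow : ∀ᶠ P in atTop, rateBound a N (Real.log P) ≤ R P)
    (hup : ∀ᶠ P in atTop, R P ≤ Real.log P) :
    Tendsto (fun P => R P / Real.log (P / N)) atTop (𝓝 1) := by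
  have h1 : Tendsto (fun P => R P / Real.log P) atTop (𝓝 1) := by
    refine tendsto_of_tendsto_of_tendsto_of_le_of_le'
      ((tendsto_rateBound_div a N).comp Real.tendsto_log_atTop) tendsto_const_nhds ?_ ?_
    · filter_upwards [hlow, Real.tendsto_log_atTop.eventually_gt_atTop 0] with P h h0
      exact div_le_div_of_nonneg_right h h0.le
    · filter_upwards [hup, Real.tendsto_log_atTop.eventually_gt_atTop 0] with P h h0
      exact (div_le_one h0).2 h
  have h2 : Tendsto (fun P => 1 - Real.log N / Real.log P) atTop (𝓝 1) := by
    simpa using (tendsto_const_nhds (x := (1 : ℝ))).sub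
      (Tendsto.div_atTop (tendsto_const_nhds (x := Real.log N)) Real.tendsto_log_atTop)
  have h3 := h1.div h2 one_ne_zero
  rw [div_one] at h3
  refine h3.congr' ?_
  filter_upwards [Real.tendsto_log_atTop.eventually_gt_atTop 0, eventually_gt_atTop 0] with P h0 hP
  rw [Real.log_div hP.ne' hN.ne', Pi.div_apply, div_div, mul_sub, mul_one,
    mul_div_cancel₀ _ h0.ne']

include ha in
/-- Uniform inputs on rings whose spacing grows like `(log P)²` achieve the full pre-logs. -/
theorem exists_ring_scheme : ∃ (W : ℝ → ℝ → Fin 3 → Finset ℝ) (ρ : ℝ → ℝ → Fin 3 → Measure ℂ),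
    (∀ P N : ℝ, 0 < P → 0 < N → ∀ l,
      (W P N l : Set ℝ) ⊆ allowedPowers a l ∧ ∀ᵐ x ∂(ρ P N l), ‖x‖ ^ 2 ∈ W P N l) ∧
    (∀ N : ℝ, 0 < N → ∀ᶠ P in atTop, ∀ l, ∀ w ∈ W P N l, 0 < w) ∧
    (c.focusScheme W ρ).AchievesHighPowerPrelog c (fun _ => 1) := by
  set A : ℝ → Finset ℂ := fun P => ringSet (spacing a P) (levels a P) with hA
  have hmem : ∀ P, ∀ᵐ x ∂(uniformOn (A P : Set ℂ)),
      ‖x‖ ^ 2 ∈ ringPowers (spacing a P) (levels a P) := fun P => by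
    filter_upwards [ae_cond_mem (A P).measurableSet] with x hx
    exact sq_norm_mem_ringPowers (spacing_nonneg a P) hx
  have hprob : ∀ P, IsProbabilityMeasure (uniformOn (A P : Set ℂ)) := fun P =>
    isProbabilityMeasure_uniformOn (A P).finite_toSet (by simpa using ringSet_nonempty)
  refine ⟨fun P _ _ => ringPowers (spacing a P) (levels a P), fun P _ _ => uniformOn (A P : Set ℂ),
    fun P N _ _ l => ⟨ringPowers_subset a P _ l, hmem P⟩, fun N _ => ?_, fun P N hP _ n k =>
    ⟨inferInstanceAs (IsProbabilityMeasure (Measure.pi _)), ?_⟩, fun N hN k => ?_⟩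
  · filter_upwards [eventually_levels_pos a] with P hP l w hw
    exact ringPowers_pos hP.2.2.1 hP.2.2.2 hw
  · refine powerConstraint_pi ?_ n
    filter_upwards [hmem P] with x hx
    exact ringPowers_le_power a hP.le hx
  · choose R hR hle hge using fun P => exists_rate_ringSet ha (P := P) hN k (levels a P)
    refine ⟨R, fun P _ => hR P, tendsto_div_log_of_bounds a hN ?_ ?_⟩
    · have hlarge := Real.tendsto_log_atTop.eventually
        ((((tendsto_levelBound_div a).eventually_const_lt zero_lt_one).and
          (eventually_gt_atTop 0)).and (((tendsto_rateBound_div a N).eventually_const_lt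
            zero_lt_one)))
      filter_upwards [eventually_levels_pos a, hlarge] with P hP hL
      obtain ⟨h4, h1, hd, hS⟩ := hP
      refine le_trans ?_ (hge P hd hS)
      set L := Real.log P with hLdef
      set s := 2 * Real.log ((levels a P : ℝ) + 1) with hs
      have hpos : 0 < levelBound a L := (div_pos_iff_of_pos_right hL.1.2).1 hL.1.1
      have hrate : 0 < rateBound a N L := (div_pos_iff_of_pos_right hL.1.2).1 hL.2
      have hs' : levelBound a L ≤ s := levelBound_le a (by linarith)
      have hS6 : ((levels a P : ℝ) + 1) ^ 6 ≤ Real.exp (3 * L) := by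
        have h := pow_le_pow_left₀ (by positivity) (levels_add_one_sq_le a h4 h1) 3
        rw [← pow_mul] at h
        refine h.trans_eq ?_
        rw [← Real.exp_log (by linarith : 0 < P), ← Real.exp_nat_mul]
        norm_num [hLdef]
      have hexp : ((levels a P : ℝ) + 1) ^ 6 * (4 * Real.exp (N / 4 - spacing a P / 16)) ≤
          4 * Real.exp (N / 4 + L * (3 - L / 8)) := by
        calc _ ≤ Real.exp (3 * L) * (4 * Real.exp (N / 4 - 2 * L ^ 2 / 16)) := by
              gcongr
              exact sq_log_le_spacing a (by linarith)
          _ = 4 * Real.exp (N / 4 + L * (3 - L / 8)) := by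
              rw [mul_left_comm, ← Real.exp_add]
              ring_nf
      -- the error probability is below `1`, as the lower bound for the rate is positive
      have hfac : 0 ≤ 1 - 4 * Real.exp (N / 4 + L * (3 - L / 8)) := by
        have hlog2 : 0 ≤ Real.log 2 := Real.log_nonneg (by norm_num)
        unfold rateBound at hrate
        exact (pos_of_mul_pos_right (by linarith) hpos.le).le
      unfold rateBound
      have := mul_le_mul hs' (sub_le_sub_left hexp 1) hfac (hpos.le.trans hs')
      linarith
    · filter_upwards [eventually_levels_pos a] with P hP
      refine (hle P).trans ?_
      have h := Real.log_le_log (by positivity) (levels_add_one_sq_le a hP.1 hP.2.1)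
      rwa [Real.log_pow] at h

end Rates

end WDM

end

theorem mainTheorem3 (c : WDM.Channel) (g : WDM.Pulse)
    (a : Fin 3 → Fin 3 → ℚ) (ha : ∀ k l, k ≠ l → c.h k l = (a k l : ℝ)) :
    -- the sampled matched-filter outputs are those of the discrete-time model, and the
    -- filters, shifted by multiples of the symbol time, are orthogonal with energy `E`
    ((∀ (n : ℕ) (x : Fin 3 → Fin n → ℂ) (k : Fin 3) (j : Fin n) (f : ℤ),
        ∫ t : ℝ, g.field c x k t * g.filter f ((j : ℕ) * g.Ts - t) = g.E * c.clean x k j f) ∧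
      (∀ (j j' : ℕ) (f f' : ℤ),
        ∫ t : ℝ, g.filter f (j * g.Ts - t) * (starRingEnd ℂ) (g.filter f' (j' * g.Ts - t)) =
          if j = j' ∧ f = f' then (g.E : ℂ) else 0)) ∧
    -- with rings in the allowed powers, exactly the filter of index `V_k[j]` carries the signal,
    -- without interference, and away from the block ends this filter is in the bank
    (∀ W : Fin 3 → Finset ℝ, (∀ l, (W l : Set ℝ) ⊆ WDM.allowedPowers a l) →
      (∀ k, ∀ v ∈ c.shifts W k, ∃ f : ℤ, v = f) ∧
      ∀ (n : ℕ) (x : Fin 3 → Fin n → ℂ), (∀ l j, ‖x l j‖ ^ 2 ∈ W l) →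
        ∀ (k : Fin 3) (j : Fin n), ∃ v : ℤ, c.V x k j = v ∧
          (∀ (z : WDM.Noise n) (f : ℤ), c.output x z k j f =
            (if f = v then x k j * Complex.exp (Complex.I * (c.h k k * ‖x k j‖ ^ 2 : ℝ)) else 0)
              + z (k, j, f)) ∧
          (c.Interior n k j → v ∈ c.focusBank W k)) ∧
    -- the branch with index `V_k[j]` is a memoryless AWGN channel
    (∀ (N : ℝ), 0 < N → ∀ (n : ℕ) (Q : Fin 3 → Measure (Fin n → ℂ)),
      (∀ l, IsProbabilityMeasure (Q l)) →
      (∀ l, ∀ᵐ x ∂(Q l), ∀ j, ‖x j‖ ^ 2 ∈ WDM.allowedPowers a l) →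
      ∀ k : Fin 3,
        (WDM.blockLaw N Q).map
            (fun ω => (ω.1 k, fun j : Fin n => c.output ω.1 ω.2 k j ⌊c.V ω.1 k j⌋)) =
          ((Q k).prod (Measure.pi fun _ : Fin n => WDM.cgauss N)).map
            (fun ω => (ω.1, fun j : Fin n =>
              ω.1 j * Complex.exp (Complex.I * (c.h k k * ‖ω.1 j‖ ^ 2 : ℝ)) + ω.2 j))) ∧
    -- i.i.d. ring inputs with these filter banks achieve the pre-log triple `(1, 1, 1)`
    ∃ (W : ℝ → ℝ → Fin 3 → Finset ℝ) (ρ : ℝ → ℝ → Fin 3 → Measure ℂ),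
      (∀ P N : ℝ, 0 < P → 0 < N → ∀ l,
        (W P N l : Set ℝ) ⊆ WDM.allowedPowers a l ∧ ∀ᵐ x ∂(ρ P N l), ‖x‖ ^ 2 ∈ W P N l) ∧
      (∀ N : ℝ, 0 < N → ∀ᶠ P in atTop, ∀ l, ∀ w ∈ W P N l, 0 < w) ∧
      (c.focusScheme W ρ).AchievesHighPowerPrelog c (fun _ => 1) := by
  exact ⟨⟨fun n x k j f => g.integral_field_mul_filter c x k j f,
      g.integral_filter_mul_conj_filter⟩,
    WDM.Channel.focusing ha, fun N _ _ Q hQ hpow k => WDM.map_selected_branch ha N Q hQ hpow k,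
    WDM.exists_ring_scheme ha⟩
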